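/- Let $\beta\in\mathbb R$. Put $r_i=\frac13$ for $1\le i\le 3$ and $$r_i=\frac13\Big(\frac1i+\frac1{i(\log\log i)^{\beta}}\Big)\qquad\text{for } i\ge 4,$$ and set $p_0=1$ and $p_n=\frac13+r_n$ for $n\ge1$. Assume that $\beta$ is such that $p_n\in(0,1)$ for all $n\ge1$. Let $X=(X_k)_{k\ge0}$ be a Markov chain on $\{0,1,2,\dots\}$, with arbitrary initial distribution, whose transition probabilities are $$P(X_{k+1}=n+2\mid X_k=n)=p_n\ (n\ge0),\qquad P(X_{k+1}=n-1\mid X_k=n)=1-p_n\ (n\ge1).$$ Call a site $k\in\{0,1,2,\dots\}$ a skipped point of $X$ if $X_n\ne k$ for all $n\ge0$. Then: - if $\beta>1$, almost surely $X$ has at most finitely many skipped points; - if $\beta\le1$, then $X$ has infinitely many skipped points with probability at least $\frac{11}{27}$. -/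

import Mathlib

/-- The perturbation `r_i` (meaningful for `i ≥ 1`). -/
noncomputable def perturbation (β : ℝ) (i : ℕ) : ℝ :=
  if i ≤ 3 then 1 / 3
  else (1 / 3) * (1 / (i : ℝ) + 1 / ((i : ℝ) * (Real.log (Real.log (i : ℝ))) ^ β))

/-- The probability `p_n` of the jump `n → n + 2`: `p_0 = 1` and `p_n = 1/3 + r_n` for `n ≥ 1`. -/
noncomputable def upProb (r : ℕ → ℝ) (n : ℕ) : ℝ :=
  if n = 0 then 1 else 1 / 3 + r n

/-- Transition matrix of the (1,2) random walk on `{0, 1, 2, ...}`: from `n` the walk jumps to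
`n + 2` with probability `p n`, and to `n - 1` (when `n ≥ 1`) with probability `1 - p n`. -/
noncomputable def walkTransition (p : ℕ → ℝ) (n m : ℕ) : ℝ :=
  if m = n + 2 then p n else if m + 1 = n then 1 - p n else 0

/-- `X` is a time-homogeneous Markov chain on `ℕ` under `P` with transition matrix `T`
(and an arbitrary initial distribution):
`P(X_0 = x_0, ..., X_{k+1} = x_{k+1}) = P(X_0 = x_0, ..., X_k = x_k) * T x_k x_{k+1}`. -/
structure IsMarkovChainWith {Ω : Type*} [MeasurableSpace Ω] (P : MeasureTheory.Measure Ω)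
    (T : ℕ → ℕ → ℝ) (X : ℕ → Ω → ℕ) : Prop where
  measurable : ∀ k, Measurable (X k)
  markov : ∀ (k : ℕ) (x : ℕ → ℕ),
    P.real {ω | ∀ i ≤ k + 1, X i ω = x i} =
      P.real {ω | ∀ i ≤ k, X i ω = x i} * T (x k) (x (k + 1))

/-- The set of skipped points of the path `n ↦ X n ω`: the sites that are never visited. -/
def skippedPoints {Ω : Type*} (X : ℕ → Ω → ℕ) (ω : Ω) : Set ℕ :=
  {k | ∀ n, X n ω ≠ k}

open MeasureTheory ProbabilityTheory Filter Topology

/-! Far out `p n = (1 + 1/n + t n) / 3` with `t n = (log log n)^(-β) / n`, so the drift is `1/n + t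
n` and the variance is close to 2: a two-dimensional Bessel process with a small extra drift.
Heuristically the generator maps `exp (-c ∑ t)` to `c (c - 1) t²` times itself, because the drift
`1/n` cancels the decay of `t`. Hence `∏ (1 - c * t i)` is superharmonic for `c = 1/2` and
subharmonic for `c = 2`. A maximum principle on finite windows turns these barriers into bounds on
hitting probabilities; in particular the chance of never visiting `k` from `k + 1` is of order `t k`
(`exists_escProb_comparable`). Upward jumps have size two and downward jumps size one, so a walk
that skips `j` from below jumps from `j - 1` to `j + 1` and stays above. This gives the
factorization `real_mul_escProb`.

For `β > 1`, look at the last skipped site `k` below `4a`. Given that it lies in `[2a, 4a)`, a site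
`j` at distance at most `a` below it is also skipped with probability at least a constant over `k -
j`. The conditional expected number of skipped sites in `[a, 4a)` is therefore at least of order
`log a`, while the unconditional one is of order `a * t a`. So the block contains a skipped site
with probability `O((log log a)^(-β) / log a)` (`exists_real_block_le`). This is summable over `a =
2 ^ m`, and Borel–Cantelli applies.

For `β ≤ 1`, count skipped sites with weights `w k ≤ 1` for which `w k * t k = 1 / (k log k log log
k)`. The mean `M` of the count diverges. Pairs `j < k ≤ j²` contribute only `O(M)` to the second
moment. For `k > j²` the two skips are nearly independent up to the factor `12/5`, because the
starting point sees a conditional jump-over probability near `1/2`. Thus the second moment is at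
most `A M + (12/5) M²` (`exists_second_moment_le`), and a Paley–Zygmund argument gives every
probability below `5/12`, in particular `11/27`. -/

/-! ### Path measures of the walk -/

/-- Finite measures on path space are determined by the masses of the elementary cylinders. -/
theorem measure_path_ext {μ ν : Measure (ℕ → ℕ)} [IsFiniteMeasure μ] [IsFiniteMeasure ν]
    (h : ∀ (n : ℕ) (a : ℕ → ℕ), μ.real {ω | ∀ i ≤ n, ω i = a i} = ν.real {ω | ∀ i ≤ n, ω i = a i}) :
    μ = ν := by
  have hIic : ∀ n, μ.map (Finset.Iic n).restrict = ν.map (Finset.Iic n).restrict := by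
    intro n
    refine Measure.ext_of_singleton fun a => ?_
    rw [Measure.map_apply (by fun_prop) (measurableSet_singleton _),
      Measure.map_apply (by fun_prop) (measurableSet_singleton _)]
    have hset : (Finset.Iic n).restrict (π := fun _ => ℕ) ⁻¹' {a}
        = {ω : ℕ → ℕ | ∀ i ≤ n, ω i = (fun i => if hi : i ∈ Finset.Iic n then a ⟨i, hi⟩ else 0) i} := by
      ext ω
      simp only [Set.mem_preimage, Set.mem_singleton_iff, Set.mem_ofPred_eq]
      constructor
      · rintro rfl i hi
        simp [hi]
      · intro hω
        funext ⟨i, hi⟩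
        have := hω i (by simpa using hi)
        simpa [hi, dif_pos (Finset.mem_Iic.1 hi)] using this
    rw [hset]
    have := h n (fun i => if hi : i ∈ Finset.Iic n then a ⟨i, hi⟩ else 0)
    rwa [measureReal_def, measureReal_def, ENNReal.toReal_eq_toReal_iff' (by finiteness)
      (by finiteness)] at this
  have hall : ∀ I : Finset ℕ, ν.map I.restrict = μ.map I.restrict := by
    intro I
    have hI : I ⊆ Finset.Iic (I.sup id) := fun i hi => by
      simpa using Finset.le_sup (f := id) hi
    rw [← Finset.restrict₂_comp_restrict hI, ← Measure.map_map (by fun_prop) (by fun_prop),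
      ← Measure.map_map (by fun_prop) (by fun_prop), hIic]
  exact IsProjectiveLimit.unique (P := fun I => μ.map I.restrict) (fun I => rfl) hall

/-- The path `x, ω 0, ω 1, …`. -/
def consPath (x : ℕ) (ω : ℕ → ℕ) : ℕ → ℕ
  | 0 => x
  | n + 1 => ω n

theorem measurable_consPath (x : ℕ) : Measurable (consPath x) := by
  refine measurable_pi_lambda _ fun n => ?_
  cases n with
  | zero => exact measurable_const
  | succ n => exact measurable_pi_apply n

/-- The up-probabilities `p` are admissible: reflection at `0`, nondegenerate elsewhere. -/
structure IsUpProb (p : ℕ → ℝ) : Prop where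
  zero : p 0 = 1
  pos : ∀ n, 0 < p n
  lt_one : ∀ n, 1 ≤ n → p n < 1

theorem IsUpProb.le_one {p : ℕ → ℝ} (h : IsUpProb p) (n : ℕ) : p n ≤ 1 := by
  rcases Nat.eq_zero_or_pos n with rfl | hn
  · exact h.zero.le
  · exact (h.lt_one n hn).le

/-- `Q x` is the law of the walk with up-probabilities `p` started at `x`. -/
structure IsWalkFamily (p : ℕ → ℝ) (Q : ℕ → Measure (ℕ → ℕ)) : Prop where
  upProb : IsUpProb p
  isProbabilityMeasure : ∀ x, IsProbabilityMeasure (Q x)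
  start : ∀ x a, (Q x).real {ω | ω 0 = a} = if a = x then 1 else 0
  chain : ∀ x, IsMarkovChainWith (Q x) (walkTransition p) (fun n ω => ω n)

/-- One step of the walk. -/
noncomputable def stepMeasure (p : ℕ → ℝ) (n : ℕ) : Measure ℕ :=
  ENNReal.ofReal (p n) • Measure.dirac (n + 2) + ENNReal.ofReal (1 - p n) • Measure.dirac (n - 1)

theorem isProbabilityMeasure_stepMeasure {p : ℕ → ℝ} (h : IsUpProb p) (n : ℕ) :
    IsProbabilityMeasure (stepMeasure p n) := by
  constructor
  have h1 := (h.pos n).le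
  have h2 := h.le_one n
  simp only [stepMeasure, Measure.coe_add, Measure.coe_smul, Pi.add_apply, Pi.smul_apply,
    measure_univ, smul_eq_mul, mul_one]
  rw [← ENNReal.ofReal_add h1 (by linarith)]
  simp

theorem stepMeasure_singleton {p : ℕ → ℝ} (h : IsUpProb p) (n m : ℕ) :
    stepMeasure p n {m} = ENNReal.ofReal (walkTransition p n m) := by
  simp only [stepMeasure, Measure.coe_add, Measure.coe_smul, Pi.add_apply, Pi.smul_apply,
    smul_eq_mul, walkTransition, Measure.dirac_apply, Set.indicator_apply, Set.mem_singleton_iff,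
    Pi.one_apply]
  have h0 := h.zero
  rcases Nat.eq_zero_or_pos n with rfl | hn
  · by_cases hm : m = 2
    · subst hm; simp [h0]
    · simp [h0, hm, Ne.symm hm]
  · by_cases hm : m = n + 2
    · subst hm
      have : n - 1 ≠ n + 2 := by omega
      simp [this]
    · by_cases hm' : m + 1 = n
      · have : n - 1 = m := by omega
        simp [hm, Ne.symm hm, hm', this]
      · have : n - 1 ≠ m := by omega
        simp [hm, Ne.symm hm, hm', this]

/-- Ionescu-Tulcea for the kernels that look only at the last coordinate of the past. -/
theorem exists_isWalkFamily {p : ℕ → ℝ} (h : IsUpProb p) : ∃ Q, IsWalkFamily p Q := by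
  have := isProbabilityMeasure_stepMeasure h
  let κ : (n : ℕ) → Kernel ((i : Finset.Iic n) → ℕ) ℕ := fun n =>
    Kernel.ofFunOfCountable fun a => stepMeasure p (a ⟨n, by simp⟩)
  have hκ : ∀ n, IsMarkovKernel (κ n) := fun n => ⟨fun a => this _⟩
  refine ⟨fun x => Kernel.trajMeasure (X := fun _ => ℕ) (Measure.dirac x) κ, h, fun x => inferInstance,
    fun x a => ?_, fun x => ⟨fun k => measurable_pi_apply k, fun k a => ?_⟩⟩
  · have hm : MeasurableSet {ω : ℕ → ℕ | ω 0 = a} :=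
      measurableSet_eq_fun (measurable_pi_apply 0) measurable_const
    have hr : {ω : ℕ → ℕ | ω 0 = a} = Preorder.frestrictLe (π := fun _ => ℕ) 0 ⁻¹'
        {b | b ⟨0, by simp⟩ = a} := rfl
    have hm0 : MeasurableSet {b : (i : Finset.Iic 0) → ℕ | b ⟨0, by simp⟩ = a} :=
      measurableSet_eq_fun (measurable_pi_apply _) measurable_const
    rw [measureReal_def, Kernel.trajMeasure, Measure.bind_apply hm (Kernel.aemeasurable _),
      Measure.map_dirac' (by fun_prop), lintegral_dirac' _ (Kernel.measurable_coe _ hm), hr,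
      ← Kernel.map_apply' _ (by fun_prop) _ hm0,
      Kernel.traj_map_frestrictLe, Kernel.partialTraj_self, Kernel.id_apply,
      Measure.dirac_apply' _ hm0]
    have : ((MeasurableEquiv.piUnique (fun _ : Finset.Iic 0 => ℕ)).symm x) ⟨0, by simp⟩ = x := by
      rfl
    by_cases hax : a = x
    · rw [if_pos hax, Set.indicator_of_mem]
      · simp
      · exact this.trans hax.symm
    · rw [if_neg hax, Set.indicator_of_notMem]
      · simp
      · intro h'
        exact hax (h'.symm.trans this)
  · set μ := Kernel.trajMeasure (X := fun _ => ℕ) (Measure.dirac x) κ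
    let r : (i : Finset.Iic k) → ℕ := fun i => a i
    have h1 := Kernel.map_frestrictLe_trajMeasure_compProd_eq_map_trajMeasure
      (X := fun _ => ℕ) (κ := κ) (μ₀ := Measure.dirac x) (a := k)
    have h2 := congrArg (fun ν => ν ({r} ×ˢ {a (k + 1)})) h1
    have hmr : MeasurableSet ({r} ×ˢ {a (k + 1)} : Set (((i : Finset.Iic k) → ℕ) × ℕ)) :=
      (measurableSet_singleton _).prod (measurableSet_singleton _)
    rw [Measure.compProd_apply_prod (measurableSet_singleton _) (measurableSet_singleton _),
      lintegral_singleton, Measure.map_apply (by fun_prop) (measurableSet_singleton _),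
      Measure.map_apply (by fun_prop) hmr] at h2
    have e1 : (Preorder.frestrictLe (π := fun _ => ℕ) k ⁻¹' {r}) = {ω | ∀ i ≤ k, ω i = a i} := by
      ext ω
      simp only [Set.mem_preimage, Set.mem_singleton_iff, Set.mem_ofPred_eq]
      constructor
      · intro hω i hi
        exact congrFun hω ⟨i, by simpa using hi⟩
      · intro hω
        funext ⟨i, hi⟩
        exact hω i (by simpa using hi)
    have e2 : ((fun ω : ℕ → ℕ => (Preorder.frestrictLe (π := fun _ => ℕ) k ω, ω (k + 1))) ⁻¹'
        ({r} ×ˢ {a (k + 1)})) = {ω | ∀ i ≤ k + 1, ω i = a i} := by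
      ext ω
      have := Set.ext_iff.1 e1 ω
      simp only [Set.mem_preimage, Set.mem_singleton_iff, Set.mem_ofPred_eq] at this
      simp only [Set.mem_preimage, Set.mem_prod, Set.mem_singleton_iff, Set.mem_ofPred_eq, this]
      constructor
      · rintro ⟨h1, h2⟩ i hi
        rcases Nat.le_succ_iff.1 hi with hi | rfl
        · exact h1 i hi
        · exact h2
      · exact fun hω => ⟨fun i hi => hω i (by omega), hω _ le_rfl⟩
    rw [e1, e2] at h2
    have h3 : κ k r {a (k + 1)} = ENNReal.ofReal (walkTransition p (a k) (a (k + 1))) :=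
      stepMeasure_singleton h _ _
    have hT : 0 ≤ walkTransition p (a k) (a (k + 1)) := by
      have := (h.pos (a k)).le
      have := h.le_one (a k)
      unfold walkTransition
      split_ifs <;> linarith
    rw [measureReal_def, measureReal_def, ← h2, h3, ENNReal.toReal_mul, ENNReal.toReal_ofReal hT,
      mul_comm]

theorem measurableSet_cylinder_path (n : ℕ) (a : ℕ → ℕ) :
    MeasurableSet {ω : ℕ → ℕ | ∀ i ≤ n, ω i = a i} := by
  have : {ω : ℕ → ℕ | ∀ i ≤ n, ω i = a i} = ⋂ i, ⋂ (_ : i ≤ n), {ω | ω i = a i} := by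
    ext; simp
  rw [this]
  exact MeasurableSet.iInter fun i => MeasurableSet.iInter fun _ =>
    measurable_pi_apply i (measurableSet_singleton _)

/-- Both masses pick up the same transition factors, so their ratio keeps its initial value `c`.
Allowing `c ≠ 1` is what makes mixtures over the starting point accessible. -/
theorem IsMarkovChainWith.cylinder_eq {Ω Ω' : Type*} [MeasurableSpace Ω] [MeasurableSpace Ω']
    {P : Measure Ω} {P' : Measure Ω'} {T : ℕ → ℕ → ℝ} {X : ℕ → Ω → ℕ} {X' : ℕ → Ω' → ℕ}
    (hX : IsMarkovChainWith P T X) (hX' : IsMarkovChainWith P' T X') (c : ℝ) (a : ℕ → ℕ)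
    (h0 : P.real {ω | X 0 ω = a 0} = c * P'.real {ω | X' 0 ω = a 0}) (n : ℕ) :
    P.real {ω | ∀ i ≤ n, X i ω = a i} = c * P'.real {ω | ∀ i ≤ n, X' i ω = a i} := by
  induction n with
  | zero => simpa using h0
  | succ n ih => rw [hX.markov, hX'.markov, ih]; ring

section Family

variable {p : ℕ → ℝ} {Q : ℕ → Measure (ℕ → ℕ)}

theorem IsWalkFamily.cylinder_succ (h : IsWalkFamily p Q) (x n : ℕ) (a : ℕ → ℕ) :
    (Q x).real {ω | ∀ i ≤ n + 1, ω i = a i} = if a 0 = x then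
      p x * (Q (x + 2)).real {ω | ∀ i ≤ n, ω i = a (i + 1)} +
        (1 - p x) * (Q (x - 1)).real {ω | ∀ i ≤ n, ω i = a (i + 1)} else 0 := by
  induction n with
  | zero =>
    rw [(h.chain x).markov 0 a]
    simp only [nonpos_iff_eq_zero, forall_eq, zero_add, h.start]
    by_cases hx : a 0 = x
    · rw [if_pos hx, if_pos hx, hx, one_mul, walkTransition]
      have h0 := h.upProb.zero
      rcases Nat.eq_zero_or_pos x with hx0 | hx0
      · subst hx0
        by_cases h2 : a 1 = 2 <;> simp [h0, h2]
      · by_cases h2 : a 1 = x + 2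
        · have : a 1 ≠ x - 1 := by omega
          simp [h2, show x + 2 ≠ x - 1 by omega]
        · by_cases h3 : a 1 + 1 = x
          · have : a 1 = x - 1 := by omega
            simp [this, show x - 1 ≠ x + 2 by omega, show x - 1 + 1 = x by omega]
          · have : a 1 ≠ x - 1 := by omega
            simp [h2, h3, this]
    · simp [hx]
  | succ n ih =>
    rw [(h.chain x).markov (n + 1) a, ih, (h.chain (x + 2)).markov n (fun i => a (i + 1)),
      (h.chain (x - 1)).markov n (fun i => a (i + 1))]
    split_ifs
    · ring
    · ring

/-- Both sides are finite measures in `D` that agree on cylinders. At `x = 0` the truncated `x - 1`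
has weight `1 - p 0 = 0`. All later uses of the Markov property go through this identity. -/
theorem IsWalkFamily.first_step (h : IsWalkFamily p Q) (x : ℕ) {D : Set (ℕ → ℕ)}
    (hD : MeasurableSet D) :
    (Q x).real D = p x * (Q (x + 2)).real (consPath x ⁻¹' D) +
      (1 - p x) * (Q (x - 1)).real (consPath x ⁻¹' D) := by
  have hP := h.isProbabilityMeasure
  have hp0 := (h.upProb.pos x).le
  have hp1 : 0 ≤ 1 - p x := by linarith [h.upProb.le_one x]
  have hmain : ∀ D : Set (ℕ → ℕ), MeasurableSet D →
      (ENNReal.ofReal (p x) • (Q (x + 2)).map (consPath x) +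
      ENNReal.ofReal (1 - p x) • (Q (x - 1)).map (consPath x)).real D =
      p x * (Q (x + 2)).real (consPath x ⁻¹' D) +
      (1 - p x) * (Q (x - 1)).real (consPath x ⁻¹' D) := by
    intro D hD
    rw [measureReal_def, Measure.add_apply, Measure.smul_apply, Measure.smul_apply,
      Measure.map_apply (measurable_consPath x) hD, Measure.map_apply (measurable_consPath x) hD,
      smul_eq_mul, smul_eq_mul, ENNReal.toReal_add (by finiteness) (by finiteness),
      ENNReal.toReal_mul, ENNReal.toReal_mul, ENNReal.toReal_ofReal hp0, ENNReal.toReal_ofReal hp1]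
    rfl
  have hfin : IsFiniteMeasure (ENNReal.ofReal (p x) • (Q (x + 2)).map (consPath x) +
      ENNReal.ofReal (1 - p x) • (Q (x - 1)).map (consPath x)) := by
    constructor
    rw [Measure.add_apply, Measure.smul_apply, Measure.smul_apply,
      Measure.map_apply (measurable_consPath x) .univ,
      Measure.map_apply (measurable_consPath x) .univ, smul_eq_mul, smul_eq_mul]
    finiteness
  rw [← hmain D hD]
  congr 1
  refine measure_path_ext fun n a => ?_
  rw [hmain _ (measurableSet_cylinder_path n a)]
  cases n with
  | zero =>
    have e : consPath x ⁻¹' {ω : ℕ → ℕ | ∀ i ≤ 0, ω i = a i} = if a 0 = x then Set.univ else ∅ := by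
      ext ω
      by_cases hx : a 0 = x
      · simp [hx, consPath]
      · simp [hx, consPath, Ne.symm hx]
    rw [e]
    have := h.start x (a 0)
    simp only [nonpos_iff_eq_zero, forall_eq]
    rw [this]
    by_cases hx : a 0 = x <;> simp [hx]
  | succ n =>
    have e : consPath x ⁻¹' {ω : ℕ → ℕ | ∀ i ≤ n + 1, ω i = a i} =
        if a 0 = x then {ω : ℕ → ℕ | ∀ i ≤ n, ω i = a (i + 1)} else ∅ := by
      ext ω
      simp only [Set.mem_preimage, Set.mem_ofPred_eq]
      by_cases hx : a 0 = x
      · rw [if_pos hx]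
        constructor
        · exact fun hω i hi => hω (i + 1) (by omega)
        · intro hω i hi
          cases i with
          | zero => exact hx.symm
          | succ i => exact hω i (by omega)
      · rw [if_neg hx]
        simp only [Set.mem_empty_iff_false, iff_false]
        exact fun hω => hx (hω 0 (by omega)).symm
    rw [e, h.cylinder_succ]
    by_cases hx : a 0 = x <;> simp [hx]

/-- The law of a Markov chain with the walk's transitions is a mixture of the laws `Q x`. -/
theorem IsWalkFamily.map_eq_sum (h : IsWalkFamily p Q) {Ω : Type*} [MeasurableSpace Ω]
    {P : Measure Ω} [IsProbabilityMeasure P] {X : ℕ → Ω → ℕ}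
    (hX : IsMarkovChainWith P (walkTransition p) X) :
    P.map (fun ω n => X n ω) = Measure.sum fun x => P {ω | X 0 ω = x} • Q x := by
  have hP := h.isProbabilityMeasure
  have hmeas : Measurable (fun ω n => X n ω) := measurable_pi_lambda _ hX.measurable
  have hsum : ∑' x, P {ω | X 0 ω = x} = 1 := by
    rw [← measure_iUnion]
    · have : (⋃ x, {ω | X 0 ω = x}) = Set.univ := by ext; simp
      rw [this, measure_univ]
    · intro x y hxy
      refine Set.disjoint_left.2 fun ω h1 h2 => hxy ?_
      exact h1.symm.trans h2
    · exact fun x => hX.measurable 0 (measurableSet_singleton x)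
  have hfin : IsFiniteMeasure (Measure.sum fun x => P {ω | X 0 ω = x} • Q x) := by
    constructor
    rw [Measure.sum_apply _ .univ]
    simp [hsum]
  have : IsProbabilityMeasure (P.map (fun ω n => X n ω)) :=
    Measure.isProbabilityMeasure_map hmeas.aemeasurable
  refine measure_path_ext fun n a => ?_
  have hm := measurableSet_cylinder_path n a
  rw [measureReal_def, measureReal_def, Measure.map_apply hmeas hm, Measure.sum_apply _ hm,
    tsum_eq_single (a 0)]
  · rw [Measure.smul_apply, smul_eq_mul, ENNReal.toReal_mul]
    refine hX.cylinder_eq (h.chain (a 0)) _ a ?_ n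
    rw [h.start]
    simp [measureReal_def]
  · intro x hx
    have hz : (Q x) {ω | ∀ i ≤ n, ω i = a i} = 0 := by
      have h1 := h.start x (a 0)
      rw [if_neg hx.symm, measureReal_eq_zero_iff] at h1
      exact measure_mono_null (fun ω hω => hω 0 (Nat.zero_le _)) h1
    simp [hz]

end Family

/-! ### The maximum principle -/

/-- The one-step average of `f` from `n`. -/
def walkAvg (p f : ℕ → ℝ) (n : ℕ) : ℝ := p n * f (n + 2) + (1 - p n) * f (n - 1)

/-- Maximum principle. The boundary consists of both `k` and `k + 1` since upward jumps have size
two; no lower boundary is needed because `0` reflects. -/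
theorem nonpos_of_le_walkAvg {p f : ℕ → ℝ} (hp : IsUpProb p) {k : ℕ}
    (hf : ∀ n < k, f n ≤ 0 ∨ f n ≤ walkAvg p f n) (hk : f k ≤ 0) (hk1 : f (k + 1) ≤ 0)
    {n : ℕ} (hn : n ≤ k + 1) : f n ≤ 0 := by
  by_contra! hpos
  obtain ⟨m, hm, hmax⟩ := Finset.exists_max_image (Finset.range (k + 2)) f ⟨n, by simp; omega⟩
  have hmpos : 0 < f m := hpos.trans_le (hmax n (by simp; omega))
  -- At the rightmost maximizer the upward neighbour is strictly smaller, and `p l > 0` makes the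
  -- average strictly smaller than the maximum.
  obtain ⟨l, hl, hlm, hlast⟩ : ∃ l < k + 2, f l = f m ∧ ∀ i, l < i → i < k + 2 → f i < f m := by
    let s := (Finset.range (k + 2)).filter fun i => f i = f m
    have hs : s.Nonempty := ⟨m, by simpa [s] using hm⟩
    refine ⟨s.max' hs, ?_, ?_, ?_⟩
    · have := s.max'_mem hs
      simp only [s, Finset.mem_filter, Finset.mem_range] at this
      exact this.1
    · have := s.max'_mem hs
      simp only [s, Finset.mem_filter, Finset.mem_range] at this
      exact this.2
    · intro i hi hik
      refine lt_of_le_of_ne (hmax i (by simpa using hik)) fun h => ?_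
      have : i ≤ s.max' hs := s.le_max' i (by simp [s, h, hik])
      omega
  have hlk : l < k := by
    by_contra! h
    rcases (by omega : l = k ∨ l = k + 1) with rfl | rfl <;> linarith
  rcases hf l hlk with h | h
  · linarith
  · have h1 : f (l + 2) < f m := hlast _ (by omega) (by omega)
    have h2 : f (l - 1) ≤ f m := hmax _ (by simp; omega)
    have h3 := hp.pos l
    have h4 := hp.le_one l
    unfold walkAvg at h
    nlinarith

/-- Replace `f` by `0` below `a`. One lower boundary point suffices because downward jumps have size
one. -/
theorem nonpos_of_le_walkAvg_Ioo {p f : ℕ → ℝ} (hp : IsUpProb p) {a k : ℕ} (hak : a ≤ k)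
    (hf : ∀ n, a < n → n < k → f n ≤ walkAvg p f n) (ha : f a ≤ 0) (hk : f k ≤ 0)
    (hk1 : f (k + 1) ≤ 0) {n : ℕ} (han : a ≤ n) (hn : n ≤ k + 1) : f n ≤ 0 := by
  have := nonpos_of_le_walkAvg (f := fun n => if n < a then 0 else f n) hp (k := k) ?_ ?_ ?_ hn
  · simpa [not_lt.2 han] using this
  · intro m hm
    rcases lt_trichotomy m a with h | rfl | h
    · simp [h]
    · simp [ha]
    · right
      simpa [walkAvg, not_lt.2 h.le, show ¬ m + 2 < a by omega, show ¬ m - 1 < a by omega]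
        using hf m h hm
  · simpa [not_lt.2 hak] using hk
  · simpa [show ¬ k + 1 < a by omega] using hk1

theorem walkAvg_const (p : ℕ → ℝ) (c : ℝ) (n : ℕ) : walkAvg p (fun _ => c) n = c := by
  unfold walkAvg; ring

theorem walkAvg_sub_smul (p f g : ℕ → ℝ) (a b : ℝ) (n : ℕ) :
    walkAvg p (fun n => a * f n - b * g n) n = a * walkAvg p f n - b * walkAvg p g n := by
  unfold walkAvg; ring

theorem walkAvg_const_sub (p f : ℕ → ℝ) (c : ℝ) (n : ℕ) :
    walkAvg p (fun n => c - f n) n = c - walkAvg p f n := by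
  unfold walkAvg; ring

/-! ### Skipping events -/

/-- The set of paths that never visit `k`. -/
def skipEvent (k : ℕ) : Set (ℕ → ℕ) := {ω | ∀ n, ω n ≠ k}

theorem measurableSet_coord_eq (n k : ℕ) : MeasurableSet {ω : ℕ → ℕ | ω n = k} :=
  measurableSet_eq_fun (measurable_pi_apply n) measurable_const

theorem measurableSet_skipEvent (k : ℕ) : MeasurableSet (skipEvent k) := by
  have : skipEvent k = ⋂ n, {ω : ℕ → ℕ | ω n = k}ᶜ := by
    ext; simp [skipEvent]
  rw [this]
  exact MeasurableSet.iInter fun n => (measurableSet_coord_eq n k).compl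

theorem consPath_mem_skipEvent {x k : ℕ} {ω : ℕ → ℕ} :
    consPath x ω ∈ skipEvent k ↔ x ≠ k ∧ ω ∈ skipEvent k := by
  constructor
  · exact fun h => ⟨h 0, fun n => h (n + 1)⟩
  · rintro ⟨h0, h⟩ n
    cases n with
    | zero => exact h0
    | succ n => exact h n

theorem preimage_consPath_skipEvent {x k : ℕ} (h : x ≠ k) :
    consPath x ⁻¹' skipEvent k = skipEvent k := by
  ext ω
  simp [consPath_mem_skipEvent, h]

theorem preimage_consPath_skipEvent_self (k : ℕ) : consPath k ⁻¹' skipEvent k = ∅ := by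
  ext ω
  simp [consPath_mem_skipEvent]

section Family

variable {p : ℕ → ℝ} {Q : ℕ → Measure (ℕ → ℕ)}

/-- The probability that the walk started at `x` never visits `k`. -/
noncomputable def skipProb (Q : ℕ → Measure (ℕ → ℕ)) (k x : ℕ) : ℝ := (Q x).real (skipEvent k)

/-- The probability that the walk started at `k + 1` never visits `k`. -/
noncomputable def escProb (Q : ℕ → Measure (ℕ → ℕ)) (k : ℕ) : ℝ := skipProb Q k (k + 1)

theorem IsWalkFamily.real_le_one (h : IsWalkFamily p Q) (x : ℕ) (D : Set (ℕ → ℕ)) :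
    (Q x).real D ≤ 1 := by
  have := h.isProbabilityMeasure x
  exact measureReal_le_one

theorem IsWalkFamily.real_mono (h : IsWalkFamily p Q) (x : ℕ) {D E : Set (ℕ → ℕ)} (hDE : D ⊆ E) :
    (Q x).real D ≤ (Q x).real E := by
  have := h.isProbabilityMeasure x
  exact measureReal_mono hDE

theorem skipProb_nonneg (k x : ℕ) : 0 ≤ skipProb Q k x := measureReal_nonneg

theorem IsWalkFamily.skipProb_le_one (h : IsWalkFamily p Q) (k x : ℕ) : skipProb Q k x ≤ 1 :=
  h.real_le_one x _

theorem IsWalkFamily.harmonic (h : IsWalkFamily p Q) {x : ℕ} {D : Set (ℕ → ℕ)}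
    (hD : MeasurableSet D) (hx : consPath x ⁻¹' D = D) :
    (Q x).real D = walkAvg p (fun n => (Q n).real D) x := by
  rw [h.first_step x hD, hx]; rfl

theorem IsWalkFamily.real_eq_zero_of_subset_skipEvent (h : IsWalkFamily p Q) {k : ℕ}
    {D : Set (ℕ → ℕ)} (hD : D ⊆ skipEvent k) : (Q k).real D = 0 := by
  refine le_antisymm ((h.real_mono k hD).trans ?_) measureReal_nonneg
  rw [h.first_step k (measurableSet_skipEvent k), preimage_consPath_skipEvent_self]
  simp

theorem IsWalkFamily.skipProb_self (h : IsWalkFamily p Q) (k : ℕ) : skipProb Q k k = 0 :=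
  h.real_eq_zero_of_subset_skipEvent subset_rfl

theorem IsWalkFamily.skipProb_harmonic (h : IsWalkFamily p Q) {k x : ℕ} (hx : x ≠ k) :
    skipProb Q k x = walkAvg p (skipProb Q k) x :=
  h.harmonic (measurableSet_skipEvent k) (preimage_consPath_skipEvent hx)

/-- Downward jumps have size one, so a walk above `k` that avoids `k` stays above `k`. -/
theorem IsWalkFamily.skipEvent_above (h : IsWalkFamily p Q) {j k n : ℕ} (hjk : j < k)
    (hn : k < n) (D : Set (ℕ → ℕ)) :
    (Q n).real (skipEvent j ∩ (skipEvent k ∩ D)) = (Q n).real (skipEvent k ∩ D) := by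
  have hP := h.isProbabilityMeasure
  -- Induction on the time of the visit to `j`: a step down from `n > k` either stays above `k` or
  -- lands on `k`, which is excluded.
  have hz : ∀ t n, k < n → (Q n).real ({ω | ω t = j} ∩ skipEvent k) = 0 := by
    intro t
    induction t with
    | zero =>
      intro n hn
      refine le_antisymm ((h.real_mono n Set.inter_subset_left).trans ?_) measureReal_nonneg
      rw [h.start, if_neg (by omega)]
    | succ t ih =>
      intro n hn
      have e : consPath n ⁻¹' ({ω | ω (t + 1) = j} ∩ skipEvent k) =
          {ω | ω t = j} ∩ skipEvent k := by
        rw [Set.preimage_inter, preimage_consPath_skipEvent hn.ne']; rfl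
      rw [h.first_step n ((measurableSet_coord_eq _ _).inter (measurableSet_skipEvent k)), e,
        ih _ (by omega)]
      rcases (by omega : k < n - 1 ∨ n - 1 = k) with h' | h'
      · rw [ih _ h']; simp
      · rw [h', h.real_eq_zero_of_subset_skipEvent Set.inter_subset_right]; simp
  have hnull : (Q n) (skipEvent k \ skipEvent j) = 0 := by
    have : skipEvent k \ skipEvent j = ⋃ t, {ω | ω t = j} ∩ skipEvent k := by
      ext ω
      simp only [Set.mem_sdiff, skipEvent, Set.mem_ofPred_eq, not_forall, not_not, Set.mem_iUnion,
        Set.mem_inter_iff]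
      tauto
    rw [this, measure_iUnion_null_iff]
    intro t
    exact (measureReal_eq_zero_iff).1 (hz t n hn)
  refine measureReal_congr ?_
  refine (Set.inter_subset_right.eventuallyLE).antisymm ?_
  rw [ae_le_set]
  refine measure_mono_null (fun ω hω => ?_) hnull
  exact ⟨hω.1.1, fun hj => hω.2 ⟨hj, hω.1⟩⟩

/-! ### Comparison with sub- and superharmonic functions -/

/-- `H` along the walk stopped at `j` is a nonnegative supermartingale. The bound is proved for
hitting `j` within `t` steps and then `t → ∞`; nonnegativity removes any condition at infinity. -/
theorem IsWalkFamily.one_sub_skipProb_le (h : IsWalkFamily p Q) {j : ℕ} {H : ℕ → ℝ}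
    (hH : ∀ n, j < n → walkAvg p H n ≤ H n) (hH0 : ∀ n, j ≤ n → 0 ≤ H n) {n : ℕ} (hn : j ≤ n) :
    (1 - skipProb Q j n) * H j ≤ H n := by
  have hP := h.isProbabilityMeasure
  let A : ℕ → Set (ℕ → ℕ) := fun t => {ω | ∃ s ≤ t, ω s = j}
  have hAm : ∀ t, MeasurableSet (A t) := by
    intro t
    have : A t = ⋃ s, ⋃ (_ : s ≤ t), {ω | ω s = j} := by ext; simp [A]
    rw [this]
    exact MeasurableSet.iUnion fun s => MeasurableSet.iUnion fun _ => measurableSet_coord_eq s j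
  have hbound : ∀ t n, j ≤ n → (Q n).real (A t) * H j ≤ H n := by
    intro t
    induction t with
    | zero =>
      intro n hn
      have : A 0 = {ω | ω 0 = j} := by ext; simp [A]
      rw [this, h.start]
      by_cases hjn : j = n
      · simp [hjn]
      · simpa [hjn] using hH0 n hn
    | succ t ih =>
      intro n hn
      rcases hn.eq_or_lt with rfl | hlt
      · exact mul_le_of_le_one_left (hH0 _ le_rfl) (h.real_le_one _ _)
      · have e : consPath n ⁻¹' (A (t + 1)) = A t := by
          ext ω
          constructor
          · rintro ⟨s, hs, hsj⟩
            cases s with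
            | zero => exact absurd hsj hlt.ne'
            | succ s => exact ⟨s, by omega, hsj⟩
          · rintro ⟨s, hs, hsj⟩
            exact ⟨s + 1, by omega, hsj⟩
        rw [h.first_step n (hAm _), e]
        have h1 := ih (n + 2) (by omega)
        have h2 := ih (n - 1) (by omega)
        have h3 := hH n hlt
        have h4 := h.upProb.pos n
        have h5 := h.upProb.le_one n
        unfold walkAvg at h3
        nlinarith
  have hU : (skipEvent j)ᶜ = ⋃ t, A t := by
    ext ω
    simp only [skipEvent, Set.mem_compl_iff, Set.mem_ofPred_eq, not_forall, not_not, Set.mem_iUnion, A]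
    exact ⟨fun ⟨s, hs⟩ => ⟨s, s, le_rfl, hs⟩, fun ⟨_, s, _, hs⟩ => ⟨s, hs⟩⟩
  have hlim : Tendsto (fun t => (Q n).real (A t)) atTop (𝓝 (1 - skipProb Q j n)) := by
    have h1 : Monotone A := fun t t' htt ω ⟨s, hs, hsj⟩ => ⟨s, hs.trans htt, hsj⟩
    have h2 := tendsto_measure_iUnion_atTop (μ := Q n) h1
    rw [skipProb, ← probReal_compl_eq_one_sub (measurableSet_skipEvent j), hU]
    exact (ENNReal.tendsto_toReal (measure_ne_top _ _)).comp h2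
  exact le_of_tendsto (hlim.mul_const (H j)) (Eventually.of_forall fun t => hbound t n hn)

/-- Avoiding `j` forces an exit from `(j, k)` through `k` or `k + 1`. There `G j - G` is at least `G
j - G k`, while the skip probability is at most one. -/
theorem IsWalkFamily.skipProb_mul_le (h : IsWalkFamily p Q) {j k : ℕ} {G : ℕ → ℝ}
    (hG : ∀ n, j < n → n < k → G n ≤ walkAvg p G n) (hjk : j ≤ k) (hkj : G k ≤ G j)
    (hk1 : G (k + 1) ≤ G k) {n : ℕ} (hjn : j ≤ n) (hnk : n ≤ k + 1) :
    skipProb Q j n * (G j - G k) ≤ G j - G n := by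
  have key := nonpos_of_le_walkAvg_Ioo
    (f := fun n => (G j - G k) * skipProb Q j n - 1 * (G j - G n)) h.upProb hjk ?_ ?_ ?_ ?_ hjn hnk
  · linarith
  · intro m hm hmk
    rw [walkAvg_sub_smul, walkAvg_const_sub, ← h.skipProb_harmonic hm.ne']
    linarith [hG m hm hmk]
  · simp [h.skipProb_self]
  · nlinarith [h.skipProb_le_one j k]
  · nlinarith [h.skipProb_le_one j (k + 1)]

theorem measurableSet_skipEvent_inter (j k : ℕ) : MeasurableSet (skipEvent j ∩ skipEvent k) :=
  (measurableSet_skipEvent j).inter (measurableSet_skipEvent k)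

theorem preimage_consPath_skipEvent_inter {x j k : ℕ} (hj : x ≠ j) (hk : x ≠ k) :
    consPath x ⁻¹' (skipEvent j ∩ skipEvent k) = skipEvent j ∩ skipEvent k := by
  rw [Set.preimage_inter, preimage_consPath_skipEvent hj, preimage_consPath_skipEvent hk]

/-- The same comparison, with boundary values `0` at `k` and at most `escProb Q k` at `k + 1`:
skipping `k` as well costs an extra factor `escProb Q k`. -/
theorem IsWalkFamily.skip_two_mul_le (h : IsWalkFamily p Q) {j k : ℕ} {G : ℕ → ℝ}
    (hG : ∀ n, j < n → n < k → G n ≤ walkAvg p G n) (hjk : j < k) (hkj : G k ≤ G j)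
    (hk1 : G (k + 1) ≤ G k) {n : ℕ} (hjn : j ≤ n) (hnk : n ≤ k + 1) :
    (Q n).real (skipEvent j ∩ skipEvent k) * (G j - G k) ≤ escProb Q k * (G j - G n) := by
  have he : 0 ≤ escProb Q k := skipProb_nonneg _ _
  have key := nonpos_of_le_walkAvg_Ioo
    (f := fun n => (G j - G k) * (Q n).real (skipEvent j ∩ skipEvent k)
      - escProb Q k * (G j - G n)) h.upProb hjk.le ?_ ?_ ?_ ?_ hjn hnk
  · linarith
  · intro m hm hmk
    rw [walkAvg_sub_smul, walkAvg_const_sub, ← h.harmonic (measurableSet_skipEvent_inter j k)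
      (preimage_consPath_skipEvent_inter hm.ne' hmk.ne)]
    nlinarith [hG m hm hmk]
  · simp [h.real_eq_zero_of_subset_skipEvent (Set.inter_subset_left : _ ∩ skipEvent k ⊆ skipEvent j)]
  · rw [h.real_eq_zero_of_subset_skipEvent Set.inter_subset_right]
    nlinarith
  · have : (Q (k + 1)).real (skipEvent j ∩ skipEvent k) ≤ escProb Q k :=
      h.real_mono _ Set.inter_subset_right
    nlinarith

/-- A walk that skips `k + 1` from below must pass through `k`: at `k + 1` the joint event is null.
So the joint probability is compared with that of skipping `j` alone, through the values at `k`.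
When the walk from `k` rarely returns to `j`, this is an upper decoupling of the two skips. -/
theorem IsWalkFamily.skip_two_mul_skipProb_le (h : IsWalkFamily p Q) {j k n : ℕ} (hjk : j ≤ k)
    (hjn : j ≤ n) (hnk : n ≤ k + 1) :
    (Q n).real (skipEvent j ∩ skipEvent (k + 1)) * skipProb Q j k ≤
      skipProb Q (k + 1) k * skipProb Q j n := by
  have key := nonpos_of_le_walkAvg_Ioo
    (f := fun n => skipProb Q j k * (Q n).real (skipEvent j ∩ skipEvent (k + 1))
      - skipProb Q (k + 1) k * skipProb Q j n) h.upProb hjk ?_ ?_ ?_ ?_ hjn hnk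
  · linarith
  · intro m hm hmk
    rw [walkAvg_sub_smul, ← h.skipProb_harmonic hm.ne',
      ← h.harmonic (measurableSet_skipEvent_inter j (k + 1))
      (preimage_consPath_skipEvent_inter hm.ne' (by omega))]
  · rw [h.skipProb_self j, h.real_eq_zero_of_subset_skipEvent Set.inter_subset_left]
    simp
  · have : (Q k).real (skipEvent j ∩ skipEvent (k + 1)) ≤ skipProb Q (k + 1) k :=
      h.real_mono _ Set.inter_subset_right
    nlinarith [skipProb_nonneg (Q := Q) j k]
  · rw [h.real_eq_zero_of_subset_skipEvent Set.inter_subset_right]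
    nlinarith [skipProb_nonneg (Q := Q) j (k + 1), skipProb_nonneg (Q := Q) (k + 1) k]

/-- Events that require skipping `j` and otherwise only concern sites above `j` factor at the
passage over `j`. -/
theorem IsWalkFamily.real_mul_escProb (h : IsWalkFamily p Q) {j : ℕ} {D : Set (ℕ → ℕ)}
    (hD : MeasurableSet D) (hDj : D ⊆ skipEvent j) (hDc : ∀ x < j, consPath x ⁻¹' D = D)
    {x : ℕ} (hx : x ≤ j + 1) :
    (Q x).real D * escProb Q j = skipProb Q j x * (Q (j + 1)).real D := by
  have hz : (Q j).real D = 0 := h.real_eq_zero_of_subset_skipEvent hDj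
  have hz' : skipProb Q j j = 0 := h.skipProb_self j
  have k1 := nonpos_of_le_walkAvg
    (f := fun n => escProb Q j * (Q n).real D - (Q (j + 1)).real D * skipProb Q j n)
    h.upProb (k := j) ?_ ?_ ?_ hx
  · have k2 := nonpos_of_le_walkAvg
      (f := fun n => (Q (j + 1)).real D * skipProb Q j n - escProb Q j * (Q n).real D)
      h.upProb (k := j) ?_ ?_ ?_ hx
    · linarith
    · intro m hm
      right
      rw [walkAvg_sub_smul, ← h.skipProb_harmonic hm.ne, ← h.harmonic hD (hDc m hm)]
    · simp [hz, hz']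
    · simp only [escProb]; linarith
  · intro m hm
    right
    rw [walkAvg_sub_smul, ← h.skipProb_harmonic hm.ne, ← h.harmonic hD (hDc m hm)]
  · simp [hz, hz']
  · simp only [escProb]; linarith

/-- Jumping over `k` from below lands on `k + 1`, so skipping `k + 1` requires hitting `k` first.
The chance of jumping over `k` instead is `skipProb Q k x / escProb Q k`. -/
theorem IsWalkFamily.skipProb_succ_mul_escProb (h : IsWalkFamily p Q) {k x : ℕ} (hx : x ≤ k) :
    skipProb Q (k + 1) x * escProb Q k =
      skipProb Q (k + 1) k * (escProb Q k - skipProb Q k x) := by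
  have hz' : skipProb Q k k = 0 := h.skipProb_self k
  have hz : skipProb Q (k + 1) (k + 1) = 0 := h.skipProb_self _
  have hsub : ∀ m < k, walkAvg p (fun n => escProb Q k - skipProb Q k n) m =
      escProb Q k - skipProb Q k m := fun m hm => by
    rw [walkAvg_const_sub, ← h.skipProb_harmonic hm.ne]
  have k1 := nonpos_of_le_walkAvg
    (f := fun n => escProb Q k * skipProb Q (k + 1) n -
      skipProb Q (k + 1) k * (escProb Q k - skipProb Q k n))
    h.upProb (k := k) ?_ ?_ ?_ (show x ≤ k + 1 by omega)
  · have k2 := nonpos_of_le_walkAvg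
      (f := fun n => skipProb Q (k + 1) k * (escProb Q k - skipProb Q k n) -
        escProb Q k * skipProb Q (k + 1) n)
      h.upProb (k := k) ?_ ?_ ?_ (show x ≤ k + 1 by omega)
    · linarith
    · intro m hm
      right
      rw [walkAvg_sub_smul, hsub m hm, ← h.skipProb_harmonic (by omega)]
    · simp [hz']; linarith
    · simp [escProb, hz]
  · intro m hm
    right
    rw [walkAvg_sub_smul, hsub m hm, ← h.skipProb_harmonic (by omega)]
  · simp [hz']; linarith
  · simp [escProb, hz]

/-- From below, `D` can occur only after a passage to `j + 1`; as a harmonic function it vanishes at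
`j`, so its maximum sits at `j + 1`. -/
theorem IsWalkFamily.real_le_of_skip (h : IsWalkFamily p Q) {j : ℕ} {D : Set (ℕ → ℕ)}
    (hD : MeasurableSet D) (hDj : D ⊆ skipEvent j) (hDc : ∀ x < j, consPath x ⁻¹' D = D)
    {x : ℕ} (hx : x ≤ j + 1) : (Q x).real D ≤ (Q (j + 1)).real D := by
  have hnn : 0 ≤ (Q (j + 1)).real D := measureReal_nonneg
  have k1 := nonpos_of_le_walkAvg
    (f := fun n => 1 * (Q n).real D - (Q (j + 1)).real D * 1)
    h.upProb (k := j) ?_ ?_ ?_ hx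
  · linarith
  · intro m hm
    right
    rw [walkAvg_sub_smul p (fun n => (Q n).real D) (fun _ => 1), walkAvg_const,
      ← h.harmonic hD (hDc m hm)]
  · simp only [h.real_eq_zero_of_subset_skipEvent hDj]; linarith
  · simp

/-- Three harmonic steps next to the boundary: the value at `k + 1` is felt at `k - 1`, `k - 2`. -/
theorem le_of_harmonic_near {f : ℕ → ℝ} {k : ℕ} (hf0 : ∀ n, 0 ≤ f n)
    (hf : ∀ n, k ≤ n → n ≤ k + 2 → f n = walkAvg p f n)
    (hp : ∀ n, k ≤ n → n ≤ k + 2 → 1 / 3 ≤ p n ∧ p n ≤ 1 / 2) :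
    f (k + 4) / 18 ≤ f (k + 1) ∧ f (k + 4) / 18 ≤ f (k + 2) := by
  have h0 := hf k le_rfl (by omega)
  have h1 := hf (k + 1) (by omega) (by omega)
  have h2 := hf (k + 2) (by omega) (by omega)
  have p0 := hp k le_rfl (by omega)
  have p1 := hp (k + 1) (by omega) (by omega)
  have p2 := hp (k + 2) (by omega) (by omega)
  simp only [walkAvg, Nat.add_sub_cancel, show k + 2 - 1 = k + 1 by omega,
    show k + 1 + 2 = k + 3 by omega, show k + 2 + 2 = k + 4 by omega] at h0 h1 h2
  have a0 := hf0 (k + 4)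
  have a1 := hf0 (k + 3)
  have a2 := hf0 (k + 2)
  have a3 := hf0 (k + 1)
  have a4 := hf0 k
  have a5 := hf0 (k - 1)
  -- Keep only the moves `k + 1 → k → k + 2 → k + 4`, of probability at least `1/2`, `1/3` and
  -- `1/3`: this is the factor `18`.
  have b2 : f (k + 4) / 3 ≤ f (k + 2) := by nlinarith
  have b0 : f (k + 2) / 3 ≤ f k := by nlinarith
  have b1 : f k / 2 ≤ f (k + 1) := by nlinarith
  constructor <;> linarith

/-- Minimum principle with the boundary values at `j + 1` and `j + 2` supplied by
`le_of_harmonic_near`. It will be used with `j + 3` a skipped site: getting over it from below costs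
only a constant. -/
theorem IsWalkFamily.le_real_of_skip (h : IsWalkFamily p Q) {j : ℕ} {D : Set (ℕ → ℕ)}
    (hD : MeasurableSet D) (hDc : ∀ x < j + 3, consPath x ⁻¹' D = D)
    (hp : ∀ n, j ≤ n → n ≤ j + 2 → 1 / 3 ≤ p n ∧ p n ≤ 1 / 2) {x : ℕ} (hx : x ≤ j + 2) :
    (Q (j + 4)).real D / 18 ≤ (Q x).real D := by
  obtain ⟨h1, h2⟩ := le_of_harmonic_near (p := p) (f := fun n => (Q n).real D) (k := j)
    (fun n => measureReal_nonneg) (fun n _ hn => h.harmonic hD (hDc n (by omega))) hp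
  have k1 := nonpos_of_le_walkAvg
    (f := fun n => (Q (j + 4)).real D / 18 * 1 - 1 * (Q n).real D)
    h.upProb (k := j + 1) ?_ ?_ ?_ hx
  · linarith
  · intro m hm
    right
    rw [walkAvg_sub_smul p (fun _ => 1) (fun n => (Q n).real D), walkAvg_const,
      ← h.harmonic hD (hDc m (by omega))]
  · linarith
  · linarith

/-- A superharmonic `H` makes `H j - H` subharmonic and zero at `j`. It therefore bounds from below
the chance of climbing to the neighbourhood of `k + 3` before returning to `j`. -/
theorem IsWalkFamily.le_real_of_skip_Ioo (h : IsWalkFamily p Q) {j k : ℕ} {D : Set (ℕ → ℕ)}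
    {H : ℕ → ℝ} (hD : MeasurableSet D) (hDc : ∀ x, j < x → x < k + 3 → consPath x ⁻¹' D = D)
    (hDj : (Q j).real D = 0)
    (hp : ∀ n, k ≤ n → n ≤ k + 2 → 1 / 3 ≤ p n ∧ p n ≤ 1 / 2) (hjk : j < k)
    (hH : ∀ n, j < n → n ≤ k → walkAvg p H n ≤ H n) (h1 : H (k + 1) ≤ H j)
    (h2 : H (k + 2) ≤ H (k + 1))
    {x : ℕ} (hjx : j ≤ x) (hx : x ≤ k + 2) :
    (Q (k + 4)).real D / 18 * (H j - H x) ≤ (Q x).real D * (H j - H (k + 2)) := by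
  obtain ⟨b1, b2⟩ := le_of_harmonic_near (p := p) (f := fun n => (Q n).real D) (k := k)
    (fun n => measureReal_nonneg) (fun n _ hn => h.harmonic hD (hDc n (by omega) (by omega))) hp
  have hnn : 0 ≤ (Q (k + 4)).real D := measureReal_nonneg
  have hnn1 : 0 ≤ (Q (k + 1)).real D := measureReal_nonneg
  have k1 := nonpos_of_le_walkAvg_Ioo
    (f := fun n => (Q (k + 4)).real D / 18 * (H j - H n) - (H j - H (k + 2)) * (Q n).real D)
    h.upProb (k := k + 1) (by omega) ?_ ?_ ?_ ?_ hjx hx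
  · linarith
  · intro m hm hmk
    rw [walkAvg_sub_smul p (fun n => H j - H n) (fun n => (Q n).real D), walkAvg_const_sub,
      ← h.harmonic hD (hDc m hm (by omega))]
    have := hH m hm (by omega)
    have : (Q (k + 4)).real D / 18 * (H j - H m) ≤
        (Q (k + 4)).real D / 18 * (H j - walkAvg p H m) := by gcongr
    linarith
  · simp [hDj]
  · nlinarith
  · nlinarith

end Family

/-! ### Two-sided estimates from multiplicative barrier functions -/

/-- `t` is a rate for which `∏ (1 - t i / 2)` is superharmonic and `∏ (1 - 2 * t i)` is
subharmonic beyond `N`. -/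
structure RateBounds (p t : ℕ → ℝ) (N : ℕ) : Prop where
  pos : ∀ n, N ≤ n → 0 < t n
  small : ∀ n, N ≤ n → t n ≤ 1 / 4
  p_lower : ∀ n, N ≤ n → 1 / 3 ≤ p n
  p_upper : ∀ n, N ≤ n → p n ≤ 17 / 50
  super : ∀ n, N ≤ n →
    p n * ((1 - t n / 2) * (1 - t (n + 1) / 2) * (1 - t (n + 2) / 2)) + (1 - p n) ≤ 1 - t n / 2
  sub : ∀ n, N ≤ n →
    1 - 2 * t n ≤ p n * ((1 - 2 * t n) * (1 - 2 * t (n + 1)) * (1 - 2 * t (n + 2))) + (1 - p n)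

theorem prod_Ioc_succ {F : ℕ → ℝ} {j n : ℕ} (h : j ≤ n) :
    ∏ i ∈ Finset.Ioc j (n + 1), F i = (∏ i ∈ Finset.Ioc j n, F i) * F (n + 1) := by
  rw [← Finset.insert_Ioc_right_eq_Ioc_add_one h, Finset.prod_insert (by simp), mul_comm]

theorem walkAvg_prod {p F : ℕ → ℝ} {j n : ℕ} (h : j < n) :
    walkAvg p (fun n => ∏ i ∈ Finset.Ioc j n, F i) n = (∏ i ∈ Finset.Ioc j (n - 1), F i) *
      (p n * (F n * F (n + 1) * F (n + 2)) + (1 - p n)) := by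
  obtain ⟨m, rfl⟩ : ∃ m, n = m + 1 := ⟨n - 1, by omega⟩
  simp only [walkAvg, show m + 1 + 2 = m + 1 + 1 + 1 from rfl, Nat.add_sub_cancel]
  rw [prod_Ioc_succ (by omega : j ≤ m + 1 + 1), prod_Ioc_succ (by omega : j ≤ m + 1),
    prod_Ioc_succ (by omega : j ≤ m)]
  ring

theorem prod_Ioc_pred {F : ℕ → ℝ} {j n : ℕ} (h : j < n) :
    ∏ i ∈ Finset.Ioc j n, F i = (∏ i ∈ Finset.Ioc j (n - 1), F i) * F n := by
  obtain ⟨m, rfl⟩ : ∃ m, n = m + 1 := ⟨n - 1, by omega⟩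
  exact prod_Ioc_succ (by omega)

theorem one_sub_sum_le_prod {u : ℕ → ℝ} {s : Finset ℕ} (hu0 : ∀ i ∈ s, 0 ≤ u i)
    (hu1 : ∀ i ∈ s, u i ≤ 1) : 1 - ∑ i ∈ s, u i ≤ ∏ i ∈ s, (1 - u i) := by
  induction s using Finset.induction_on with
  | empty => simp
  | insert a s ha ih =>
    rw [Finset.sum_insert ha, Finset.prod_insert ha]
    have h1 := ih (fun i hi => hu0 i (Finset.mem_insert_of_mem hi))
      (fun i hi => hu1 i (Finset.mem_insert_of_mem hi))
    have h2 := hu0 a (Finset.mem_insert_self a s)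
    have h3 := hu1 a (Finset.mem_insert_self a s)
    have h4 : 0 ≤ ∑ i ∈ s, u i :=
      Finset.sum_nonneg fun i hi => hu0 i (Finset.mem_insert_of_mem hi)
    nlinarith

theorem prod_one_sub_le_exp {u : ℕ → ℝ} {s : Finset ℕ} (hu : ∀ i ∈ s, u i ≤ 1) :
    ∏ i ∈ s, (1 - u i) ≤ Real.exp (-∑ i ∈ s, u i) := by
  rw [← Finset.sum_neg_distrib, Real.exp_sum]
  refine Finset.prod_le_prod (fun i hi => by linarith [hu i hi]) fun i _ => ?_
  linarith [Real.add_one_le_exp (-u i)]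

theorem exp_neg_le_inv {s : ℝ} (hs : 0 ≤ s) : Real.exp (-s) ≤ 1 / (1 + s) := by
  rw [Real.exp_neg, ← one_div]
  exact one_div_le_one_div_of_le (by linarith) (by linarith [Real.add_one_le_exp s])

section Rate

variable {p t : ℕ → ℝ} {N : ℕ}

theorem RateBounds.prod_pos (hr : RateBounds p t N) {c : ℝ} (hc2 : c ≤ 2)
    {j n : ℕ} (hj : N ≤ j) : 0 < ∏ i ∈ Finset.Ioc j n, (1 - c * t i) := by
  refine Finset.prod_pos fun i hi => ?_
  have hi' := (Finset.mem_Ioc.1 hi).1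
  nlinarith [hr.pos i (by omega), hr.small i (by omega)]

theorem RateBounds.prod_antitone (hr : RateBounds p t N) {c : ℝ} (hc0 : 0 ≤ c) (hc2 : c ≤ 2)
    {j m n : ℕ} (hj : N ≤ j) (hm : j ≤ m) (hmn : m ≤ n) :
    ∏ i ∈ Finset.Ioc j n, (1 - c * t i) ≤ ∏ i ∈ Finset.Ioc j m, (1 - c * t i) := by
  induction n, hmn using Nat.le_induction with
  | base => exact le_rfl
  | succ n hn ih =>
    rw [prod_Ioc_succ (by omega)]
    refine le_trans (mul_le_of_le_one_right (hr.prod_pos hc2 hj).le ?_) ih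
    nlinarith [hr.pos (n + 1) (by omega)]

theorem RateBounds.walkAvg_super (hr : RateBounds p t N) {j n : ℕ} (hj : N ≤ j) (hn : j < n) :
    walkAvg p (fun n => ∏ i ∈ Finset.Ioc j n, (1 - 1 / 2 * t i)) n ≤
      ∏ i ∈ Finset.Ioc j n, (1 - 1 / 2 * t i) := by
  rw [walkAvg_prod hn, prod_Ioc_pred hn]
  refine mul_le_mul_of_nonneg_left ?_ (hr.prod_pos (by norm_num) hj).le
  have := hr.super n (by omega)
  simp only [div_eq_inv_mul, mul_one] at this ⊢
  linarith

theorem RateBounds.walkAvg_sub (hr : RateBounds p t N) {j n : ℕ} (hj : N ≤ j) (hn : j < n) :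
    ∏ i ∈ Finset.Ioc j n, (1 - 2 * t i) ≤
      walkAvg p (fun n => ∏ i ∈ Finset.Ioc j n, (1 - 2 * t i)) n := by
  rw [walkAvg_prod hn, prod_Ioc_pred hn]
  exact mul_le_mul_of_nonneg_left (hr.sub n (by omega)) (hr.prod_pos le_rfl hj).le

variable {Q : ℕ → Measure (ℕ → ℕ)}

theorem RateBounds.one_sub_skipProb_le_prod (hr : RateBounds p t N) (h : IsWalkFamily p Q)
    {j n : ℕ} (hj : N ≤ j) (hn : j ≤ n) :
    1 - skipProb Q j n ≤ ∏ i ∈ Finset.Ioc j n, (1 - 1 / 2 * t i) := by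
  simpa using h.one_sub_skipProb_le (j := j)
    (H := fun n => ∏ i ∈ Finset.Ioc j n, (1 - 1 / 2 * t i))
    (fun n hn => hr.walkAvg_super hj hn) (fun n _ => (hr.prod_pos (by norm_num) hj).le) hn

theorem RateBounds.one_sub_skipProb_le_exp (hr : RateBounds p t N) (h : IsWalkFamily p Q)
    {j n : ℕ} (hj : N ≤ j) (hn : j ≤ n) :
    1 - skipProb Q j n ≤ Real.exp (-(1 / 2 * ∑ i ∈ Finset.Ioc j n, t i)) := by
  refine (hr.one_sub_skipProb_le_prod h hj hn).trans ?_
  rw [Finset.mul_sum]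
  refine prod_one_sub_le_exp fun i hi => ?_
  linarith [hr.small i (by have := (Finset.mem_Ioc.1 hi).1; omega)]

theorem RateBounds.le_escProb (hr : RateBounds p t N) (h : IsWalkFamily p Q) {j : ℕ}
    (hj : N ≤ j) : t (j + 1) / 2 ≤ escProb Q j := by
  have := hr.one_sub_skipProb_le_prod h hj (Nat.le_succ j)
  rw [prod_Ioc_succ le_rfl] at this
  simp only [Finset.Ioc_self, Finset.prod_empty, one_mul] at this
  unfold escProb
  linarith

theorem RateBounds.escProb_pos (hr : RateBounds p t N) (h : IsWalkFamily p Q) {j : ℕ}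
    (hj : N ≤ j) : 0 < escProb Q j := by
  linarith [hr.le_escProb h hj, hr.pos (j + 1) (by omega)]

/-- With `s = ∑ t i` this is `1 - exp (-2 s) ≥ 2 s / (1 + 2 s)`, cleared of denominators. -/
theorem RateBounds.sub_prod_ge (hr : RateBounds p t N) {j k : ℕ} (hj : N ≤ j) :
    2 * ∑ i ∈ Finset.Ioc j k, t i ≤ (1 - ∏ i ∈ Finset.Ioc j k, (1 - 2 * t i)) *
      (1 + 2 * ∑ i ∈ Finset.Ioc j k, t i) := by
  set s := ∑ i ∈ Finset.Ioc j k, t i with hs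
  have hs0 : 0 ≤ s := Finset.sum_nonneg fun i hi =>
    (hr.pos i (by have := (Finset.mem_Ioc.1 hi).1; omega)).le
  have h1 : ∏ i ∈ Finset.Ioc j k, (1 - 2 * t i) ≤ 1 / (1 + 2 * s) := by
    refine le_trans (prod_one_sub_le_exp (u := fun i => 2 * t i) fun i hi => ?_) ?_
    · linarith [hr.small i (by have := (Finset.mem_Ioc.1 hi).1; omega)]
    · rw [← Finset.mul_sum, ← hs]
      exact exp_neg_le_inv (by linarith)
  rw [le_div_iff₀ (by linarith)] at h1
  linarith

/-- The subharmonic barrier bounds the chance of leaving `(j, k)` upward from `j + 1` by `2 t (j +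
1)` over the drop of the barrier across the window. -/
theorem RateBounds.escProb_mul_sum_le (hr : RateBounds p t N) (h : IsWalkFamily p Q) {j k : ℕ}
    (hj : N ≤ j) (hjk : j < k) :
    escProb Q j * ∑ i ∈ Finset.Ioc j k, t i ≤
      t (j + 1) * (1 + 2 * ∑ i ∈ Finset.Ioc j k, t i) := by
  have h1 := h.skipProb_mul_le (j := j) (k := k) (n := j + 1)
    (G := fun n => ∏ i ∈ Finset.Ioc j n, (1 - 2 * t i))
    (fun n hn _ => hr.walkAvg_sub hj hn) hjk.le
    (hr.prod_antitone (by norm_num) le_rfl hj le_rfl hjk.le)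
    (hr.prod_antitone (by norm_num) le_rfl hj hjk.le (Nat.le_succ k)) (by omega) (by omega)
  rw [prod_Ioc_succ le_rfl] at h1
  simp only [Finset.Ioc_self, Finset.prod_empty, one_mul] at h1
  have h2 := hr.sub_prod_ge (k := k) hj
  have h3 := (hr.escProb_pos h hj).le
  have hs0 : 0 ≤ ∑ i ∈ Finset.Ioc j k, t i := Finset.sum_nonneg fun i hi =>
    (hr.pos i (by have := (Finset.mem_Ioc.1 hi).1; omega)).le
  have h4 := mul_le_mul_of_nonneg_left h2 h3
  have h5 := mul_le_mul_of_nonneg_right h1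
    (show 0 ≤ 1 + 2 * ∑ i ∈ Finset.Ioc j k, t i by linarith)
  unfold escProb at *
  linarith

theorem RateBounds.skip_two_mul_sum_le (hr : RateBounds p t N) (h : IsWalkFamily p Q) {j k : ℕ}
    (hj : N ≤ j) (hjk : j < k) :
    (Q (j + 1)).real (skipEvent j ∩ skipEvent k) * ∑ i ∈ Finset.Ioc j k, t i ≤
      escProb Q k * (t (j + 1) * (1 + 2 * ∑ i ∈ Finset.Ioc j k, t i)) := by
  have h1 := h.skip_two_mul_le (j := j) (k := k) (n := j + 1)
    (G := fun n => ∏ i ∈ Finset.Ioc j n, (1 - 2 * t i))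
    (fun n hn _ => hr.walkAvg_sub hj hn) hjk
    (hr.prod_antitone (by norm_num) le_rfl hj le_rfl hjk.le)
    (hr.prod_antitone (by norm_num) le_rfl hj hjk.le (Nat.le_succ k)) (by omega) (by omega)
  rw [prod_Ioc_succ le_rfl] at h1
  simp only [Finset.Ioc_self, Finset.prod_empty, one_mul] at h1
  have h2 := hr.sub_prod_ge (k := k) hj
  have h3 : 0 ≤ (Q (j + 1)).real (skipEvent j ∩ skipEvent k) := measureReal_nonneg
  have hs0 : 0 ≤ ∑ i ∈ Finset.Ioc j k, t i := Finset.sum_nonneg fun i hi =>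
    (hr.pos i (by have := (Finset.mem_Ioc.1 hi).1; omega)).le
  have h4 := mul_le_mul_of_nonneg_left h2 h3
  have h5 := mul_le_mul_of_nonneg_right h1
    (show 0 ≤ 1 + 2 * ∑ i ∈ Finset.Ioc j k, t i by linarith)
  linarith

/-- From `j + 1` the walk climbs to the neighbourhood of `k + 3` before `j` with chance at least of
order `t (j + 1) / ∑ t`. The superharmonic barrier drops by `t (j + 1) / 2` at the first site and by
at most `(1/2) ∑ t` in total. -/
theorem RateBounds.le_real_mul_sum (hr : RateBounds p t N) (h : IsWalkFamily p Q) {j k : ℕ}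
    {D : Set (ℕ → ℕ)} (hD : MeasurableSet D)
    (hDc : ∀ x, j < x → x < k + 3 → consPath x ⁻¹' D = D) (hDj : (Q j).real D = 0)
    (hj : N ≤ j) (hjk : j < k) :
    (Q (k + 4)).real D / 18 * t (j + 1) ≤
      (Q (j + 1)).real D * ∑ i ∈ Finset.Ioc j (k + 2), t i := by
  have h1 := h.le_real_of_skip_Ioo (j := j) (k := k) (x := j + 1)
    (H := fun n => ∏ i ∈ Finset.Ioc j n, (1 - 1 / 2 * t i)) hD hDc hDj
    (fun n hn _ => ⟨hr.p_lower n (by omega), (hr.p_upper n (by omega)).trans (by norm_num)⟩) hjk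
    (fun n hn _ => hr.walkAvg_super hj hn)
    (hr.prod_antitone (by norm_num) (by norm_num) hj le_rfl (by omega))
    (hr.prod_antitone (by norm_num) (by norm_num) hj (by omega) (by omega)) (by omega) (by omega)
  rw [prod_Ioc_succ le_rfl] at h1
  simp only [Finset.Ioc_self, Finset.prod_empty, one_mul] at h1
  have h2 := one_sub_sum_le_prod (u := fun i => 1 / 2 * t i) (s := Finset.Ioc j (k + 2))
    (fun i hi => by linarith [hr.pos i (by have := (Finset.mem_Ioc.1 hi).1; omega)])
    (fun i hi => by linarith [hr.small i (by have := (Finset.mem_Ioc.1 hi).1; omega)])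
  rw [← Finset.mul_sum] at h2
  have h3 : 0 ≤ (Q (j + 1)).real D := measureReal_nonneg
  nlinarith

end Rate

/-! ### Asymptotics of the rate -/

/-- The slowly varying factor `(log log n) ^ (-β)`. -/
noncomputable def slowFactor (β : ℝ) (n : ℕ) : ℝ := Real.log (Real.log n) ^ (-β)

/-- The rate `(log log n) ^ (-β) / n`. -/
noncomputable def logRate (β : ℝ) (n : ℕ) : ℝ := slowFactor β n / n

/-- Here `s = 1/n`. To second order `1 - ∏ (1 - c t i)` is `3 c t0 (1 - s - c t0)`; multiplied by
`(1 + s + t0) / 3` it gives `c t0 (1 + (1 - c) t0)` up to `s²` and smaller terms. The sign of `1 -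
c` decides, and `c = 1/2` leaves room for the errors. -/
theorem super_of_rate {t0 t1 t2 s : ℝ} (ht0 : 0 < t0) (hs : 0 ≤ s)
    (h1 : |t1 - t0 * (1 - s)| ≤ t0 ^ 2 / 100) (h2 : |t2 - t0 * (1 - 2 * s)| ≤ t0 ^ 2 / 100)
    (hst : s ^ 2 ≤ t0 / 100) (hs1 : s ≤ 1 / 100) (ht : t0 ≤ 1 / 100) :
    (1 / 3 * (1 + s + t0)) * ((1 - t0 / 2) * (1 - t1 / 2) * (1 - t2 / 2)) +
      (1 - 1 / 3 * (1 + s + t0)) ≤ 1 - t0 / 2 := by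
  rw [abs_le] at h1 h2
  have u1 : t1 ≤ 101 / 100 * t0 := by nlinarith
  have u2 : t2 ≤ 101 / 100 * t0 := by nlinarith
  have l1 : 0 ≤ t1 := by nlinarith
  have l2 : 0 ≤ t2 := by nlinarith
  have pr : t0 * t1 + t0 * t2 + t1 * t2 ≤ 31 / 10 * t0 ^ 2 := by
    nlinarith [mul_le_mul u1 u2 l2 (by linarith : (0:ℝ) ≤ 101 / 100 * t0)]
  have cu : 0 ≤ t0 * t1 * t2 := by positivity
  have sm : t0 * (3 - 3 * s - t0 / 50) ≤ t0 + t1 + t2 := by nlinarith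
  have key : t0 / 2 * (3 - 3 * s - 157 / 100 * t0) ≤
      1 - (1 - t0 / 2) * (1 - t1 / 2) * (1 - t2 / 2) := by nlinarith
  have hmul := mul_le_mul_of_nonneg_left key (show 0 ≤ 1 / 3 * (1 + s + t0) by positivity)
  -- The terms linear in `s` cancel; the surplus, nearly `t0 / 2`, absorbs `s²` thanks to `hst`.
  have fin : 1 ≤ 1 / 3 * (1 + s + t0) * (3 - 3 * s - 157 / 100 * t0) := by
    nlinarith [mul_nonneg hs ht0.le]
  nlinarith

/-- The same expansion with `c = 2`. Now `-s²` has the favourable sign, so `s² = o(t0)` is not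
needed. -/
theorem sub_of_rate {t0 t1 t2 s : ℝ} (ht0 : 0 < t0) (hs : 0 ≤ s)
    (h1 : |t1 - t0 * (1 - s)| ≤ t0 ^ 2 / 100) (h2 : |t2 - t0 * (1 - 2 * s)| ≤ t0 ^ 2 / 100)
    (hs1 : s ≤ 1 / 100) (ht : t0 ≤ 1 / 100) :
    1 - 2 * t0 ≤ (1 / 3 * (1 + s + t0)) * ((1 - 2 * t0) * (1 - 2 * t1) * (1 - 2 * t2)) +
      (1 - 1 / 3 * (1 + s + t0)) := by
  rw [abs_le] at h1 h2
  have u1 : t1 ≤ 101 / 100 * t0 := by nlinarith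
  have u2 : t2 ≤ 101 / 100 * t0 := by nlinarith
  have l1 : 97 / 100 * t0 ≤ t1 := by nlinarith
  have l2 : 97 / 100 * t0 ≤ t2 := by nlinarith
  have p12 : (97 / 100 * t0) * (97 / 100 * t0) ≤ t1 * t2 :=
    mul_le_mul l1 l2 (by positivity) (by linarith)
  have p12' : t1 * t2 ≤ (101 / 100 * t0) * (101 / 100 * t0) :=
    mul_le_mul u1 u2 (by linarith) (by linarith)
  have pr : 28 / 10 * t0 ^ 2 ≤ t0 * t1 + t0 * t2 + t1 * t2 := by nlinarith
  have cu : t0 * t1 * t2 ≤ 2 / 100 * t0 ^ 2 := by nlinarith [mul_pos ht0 ht0]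
  have sm : t0 + t1 + t2 ≤ t0 * (3 - 3 * s + t0 / 50) := by nlinarith
  have key : 1 - (1 - 2 * t0) * (1 - 2 * t1) * (1 - 2 * t2) ≤
      2 * t0 * (3 - 3 * s - 5 * t0) := by nlinarith
  have hmul := mul_le_mul_of_nonneg_left key (show 0 ≤ 1 / 3 * (1 + s + t0) by positivity)
  have fin : 1 / 3 * (1 + s + t0) * (3 - 3 * s - 5 * t0) ≤ 1 := by
    nlinarith [mul_nonneg hs ht0.le, sq_nonneg s, sq_nonneg t0]
  nlinarith

theorem tendsto_log_nat : Tendsto (fun n : ℕ => Real.log n) atTop atTop :=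
  Real.tendsto_log_atTop.comp tendsto_natCast_atTop_atTop

theorem tendsto_loglog_nat : Tendsto (fun n : ℕ => Real.log (Real.log n)) atTop atTop :=
  Real.tendsto_log_atTop.comp tendsto_log_nat

theorem eventually_loglog_rpow_le (s : ℝ) :
    ∀ᶠ n : ℕ in atTop, Real.log (Real.log n) ^ s ≤ Real.log n ^ (1 / 2 : ℝ) := by
  have h := (isLittleO_log_rpow_rpow_atTop s (show (0 : ℝ) < 1 / 2 by norm_num)).bound
    (show (0 : ℝ) < 1 by norm_num)
  filter_upwards [tendsto_log_nat.eventually h, tendsto_log_nat.eventually_ge_atTop 1,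
    tendsto_loglog_nat.eventually_ge_atTop 1] with n hn h1 h2
  rw [one_mul, Real.norm_of_nonneg (by positivity), Real.norm_of_nonneg (by positivity)] at hn
  exact hn

theorem tendsto_slowFactor_mul_log (β : ℝ) :
    Tendsto (fun n : ℕ => slowFactor β n * Real.log n) atTop atTop := by
  have h1 : Tendsto (fun n : ℕ => Real.log n ^ (1 / 2 : ℝ)) atTop atTop :=
    (tendsto_rpow_atTop (by norm_num)).comp tendsto_log_nat
  refine tendsto_atTop_mono' _ ?_ h1
  filter_upwards [eventually_loglog_rpow_le β, tendsto_log_nat.eventually_ge_atTop 1,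
    tendsto_loglog_nat.eventually_ge_atTop 1] with n hn h2 h3
  have hpos : 0 < Real.log (Real.log n) ^ β := Real.rpow_pos_of_pos (by linarith) _
  have hl : Real.log n = Real.log n ^ (1 / 2 : ℝ) * Real.log n ^ (1 / 2 : ℝ) := by
    rw [← Real.rpow_add (by linarith)]; norm_num
  have hl0 : 0 ≤ Real.log n ^ (1 / 2 : ℝ) := by positivity
  rw [slowFactor, Real.rpow_neg (by linarith), inv_mul_eq_div, le_div_iff₀ hpos]
  exact (mul_le_mul_of_nonneg_left hn hl0).trans hl.symm.le

theorem eventually_slowFactor_pos (β : ℝ) : ∀ᶠ n : ℕ in atTop, 0 < slowFactor β n := by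
  filter_upwards [tendsto_loglog_nat.eventually_ge_atTop 1] with n h3
  exact Real.rpow_pos_of_pos (by linarith) _

theorem eventually_logRate_pos (β : ℝ) : ∀ᶠ n : ℕ in atTop, 0 < logRate β n := by
  filter_upwards [eventually_slowFactor_pos β, eventually_gt_atTop 0] with n h hn
  have : (0 : ℝ) < n := by exact_mod_cast hn
  exact div_pos h this

theorem tendsto_log_div_nat : Tendsto (fun n : ℕ => Real.log n / n) atTop (𝓝 0) :=
  (Real.isLittleO_log_id_atTop.tendsto_div_nhds_zero).comp tendsto_natCast_atTop_atTop

theorem tendsto_logRate (β : ℝ) : Tendsto (logRate β) atTop (𝓝 0) := by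
  refine squeeze_zero' ?_ ?_ tendsto_log_div_nat
  · filter_upwards [eventually_logRate_pos β] with n h using h.le
  · filter_upwards [eventually_loglog_rpow_le (-β), tendsto_log_nat.eventually_ge_atTop 1]
      with n hn h1
    unfold logRate slowFactor
    gcongr
    refine hn.trans ?_
    calc Real.log n ^ (1 / 2 : ℝ) ≤ Real.log n ^ (1 : ℝ) :=
          Real.rpow_le_rpow_of_exponent_le h1 (by norm_num)
      _ = _ := Real.rpow_one _

/-- The ratio `n * log n * logRate β n` is `slowFactor β n * log n`, and no power of `log log n` can
compensate `log n`. -/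
theorem eventually_one_div_mul_log_le (β : ℝ) {κ : ℝ} (hκ : 0 < κ) :
    ∀ᶠ n : ℕ in atTop, 1 / (n * Real.log n) ≤ κ * logRate β n := by
  filter_upwards [(tendsto_slowFactor_mul_log β).eventually_ge_atTop (1 / κ),
    tendsto_log_nat.eventually_ge_atTop 1, eventually_gt_atTop 0] with n hn h1 h0
  have h0' : (0 : ℝ) < n := by exact_mod_cast h0
  have hl : 0 < Real.log n := by linarith
  rw [div_le_iff₀ hκ] at hn
  rw [logRate, div_le_iff₀ (by positivity)]
  calc (1 : ℝ) ≤ slowFactor β n * Real.log n * κ := hn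
    _ = κ * (slowFactor β n / n) * (n * Real.log n) := by field_simp

theorem eventually_one_div_sq_le (β : ℝ) {κ : ℝ} (hκ : 0 < κ) :
    ∀ᶠ n : ℕ in atTop, (1 / (n : ℝ)) ^ 2 ≤ κ * logRate β n := by
  filter_upwards [eventually_one_div_mul_log_le β hκ,
    tendsto_log_nat.eventually_ge_atTop 1, eventually_gt_atTop 0] with n hn h1 h0
  refine le_trans ?_ hn
  have h0' : (0 : ℝ) < n := by exact_mod_cast h0
  rw [div_pow, one_pow, sq]
  have : Real.log n ≤ n := (Real.log_le_sub_one_of_pos h0').trans (by linarith)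
  gcongr

theorem abs_rpow_sub_one_le {u s : ℝ} (hu : 1 ≤ u) (hs : |s| * (u - 1) ≤ 1) :
    |u ^ s - 1| ≤ 2 * |s| * (u - 1) := by
  have hu0 : 0 < u := by linarith
  have hl : Real.log u ≤ u - 1 := Real.log_le_sub_one_of_pos hu0
  have hl0 : 0 ≤ Real.log u := Real.log_nonneg hu
  have ha : |Real.log u * s| ≤ |s| * (u - 1) := by
    rw [abs_mul, abs_of_nonneg hl0, mul_comm]
    gcongr
  rw [Real.rpow_def_of_pos hu0]
  have := Real.abs_exp_sub_one_le (ha.trans hs)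
  linarith

/-- `log log` grows by at most `1 / (n log n)` per step, hence so does its relative growth once it
is at least one. -/
theorem eventually_slowFactor_succ (β : ℝ) :
    ∀ᶠ n : ℕ in atTop, |slowFactor β (n + 1) - slowFactor β n| ≤
      2 * |β| * (1 / (n * Real.log n)) * slowFactor β n := by
  have hsm : ∀ᶠ n : ℕ in atTop, |β| * (1 / (n * Real.log n)) ≤ 1 := by
    have h1 : Tendsto (fun n : ℕ => (n : ℝ) * Real.log n) atTop atTop :=
      tendsto_natCast_atTop_atTop.atTop_mul_atTop₀ tendsto_log_nat
    filter_upwards [h1.eventually_ge_atTop |β|, h1.eventually_gt_atTop 0] with n hn hn0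
    rw [mul_one_div, div_le_one hn0]
    exact hn
  filter_upwards [hsm, tendsto_log_nat.eventually_ge_atTop 1,
    tendsto_loglog_nat.eventually_ge_atTop 1, eventually_gt_atTop 0] with n hn h1 h2 h0
  have h0' : (0 : ℝ) < n := by exact_mod_cast h0
  set l := Real.log (Real.log n)
  set l' := Real.log (Real.log ((n + 1 : ℕ) : ℝ)) with hl'
  have hlog : Real.log ((n + 1 : ℕ) : ℝ) - Real.log n ≤ 1 / n := by
    rw [← Real.log_div (by positivity) (by positivity)]
    refine (Real.log_le_sub_one_of_pos (by positivity)).trans (le_of_eq ?_)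
    push_cast
    field_simp
    ring
  have hmono : Real.log (n : ℝ) ≤ Real.log ((n + 1 : ℕ) : ℝ) :=
    Real.log_le_log h0' (by push_cast; linarith)
  have hll : l ≤ l' := Real.log_le_log (by linarith) hmono
  have hdiff : l' - l ≤ 1 / (n * Real.log n) := by
    rw [hl', ← Real.log_div (by linarith) (by linarith)]
    refine (Real.log_le_sub_one_of_pos (by apply div_pos <;> linarith)).trans ?_
    rw [div_sub_one (by linarith), ← div_div]
    gcongr
  have hu : l' / l - 1 ≤ 1 / (n * Real.log n) := by
    rw [div_sub_one (by linarith)]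
    exact (div_le_self (by linarith) h2).trans hdiff
  have hu1 : 1 ≤ l' / l := by rw [le_div_iff₀ (by linarith)]; linarith
  have hb := abs_rpow_sub_one_le (u := l' / l) (s := -β) hu1 (by
    rw [abs_neg]
    exact (mul_le_mul_of_nonneg_left hu (abs_nonneg β)).trans hn)
  have hS : 0 < slowFactor β n := Real.rpow_pos_of_pos (by linarith) _
  have he : slowFactor β (n + 1) - slowFactor β n =
      ((l' / l) ^ (-β) - 1) * slowFactor β n := by
    rw [Real.div_rpow (by linarith) (by linarith), sub_mul, one_mul]
    unfold slowFactor at hS ⊢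
    rw [div_mul_cancel₀ _ hS.ne']
  rw [he, abs_mul, abs_of_pos hS]
  refine mul_le_mul_of_nonneg_right (hb.trans ?_) hS.le
  rw [abs_neg]
  gcongr

/-- The factor `1/n` contributes the relative change `-1/n` up to `O(1/n²)`, and the slow factor
`O(1/(n log n))`; both errors are small against `logRate β n`. -/
theorem eventually_logRate_succ (β : ℝ) {κ : ℝ} (hκ : 0 < κ) :
    ∀ᶠ n : ℕ in atTop, |logRate β (n + 1) - logRate β n * (1 - 1 / n)| ≤ κ * logRate β n ^ 2 := by
  have hc : 0 < κ / (2 * (2 * |β| + 1)) := by positivity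
  filter_upwards [eventually_slowFactor_succ β, eventually_one_div_mul_log_le β hc,
    eventually_one_div_sq_le β (show 0 < κ / 2 by positivity), eventually_logRate_pos β,
    eventually_slowFactor_pos β, eventually_gt_atTop 0, tendsto_log_nat.eventually_ge_atTop 1]
    with n h1 h2 h3 h4 h5 h0 hlog
  have h0' : (0 : ℝ) < n := by exact_mod_cast h0
  have e : logRate β (n + 1) - logRate β n * (1 - 1 / n) =
      (slowFactor β (n + 1) - slowFactor β n) / (n + 1) +
        logRate β n * (1 / n * (1 / (n + 1))) := by
    unfold logRate
    push_cast
    field_simp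
    ring
  have a1 : |(slowFactor β (n + 1) - slowFactor β n) / (n + 1)| ≤ κ / 2 * logRate β n ^ 2 := by
    rw [abs_div, abs_of_pos (show (0 : ℝ) < n + 1 by positivity)]
    calc |slowFactor β (n + 1) - slowFactor β n| / (n + 1)
        ≤ |slowFactor β (n + 1) - slowFactor β n| / n := by gcongr; linarith
      _ ≤ (2 * |β| * (1 / (n * Real.log n)) * slowFactor β n) / n := by gcongr
      _ = 2 * |β| * (1 / (n * Real.log n)) * logRate β n := by unfold logRate; ring
      _ ≤ (2 * |β| + 1) * (κ / (2 * (2 * |β| + 1)) * logRate β n) * logRate β n := by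
          gcongr
          linarith
      _ = κ / 2 * logRate β n ^ 2 := by field_simp
  have a2 : |logRate β n * (1 / n * (1 / (n + 1)))| ≤ κ / 2 * logRate β n ^ 2 := by
    rw [abs_of_pos (by positivity)]
    calc logRate β n * (1 / n * (1 / (n + 1))) ≤ logRate β n * (1 / n * (1 / n)) := by
          gcongr; linarith
      _ = logRate β n * (1 / (n : ℝ)) ^ 2 := by ring
      _ ≤ logRate β n * (κ / 2 * logRate β n) := by gcongr
      _ = _ := by ring
  rw [e]
  refine (abs_add_le _ _).trans ?_
  linarith

theorem eventually_logRate_add_two (β : ℝ) :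
    ∀ᶠ n : ℕ in atTop,
      |logRate β (n + 2) - logRate β n * (1 - 2 * (1 / n))| ≤ logRate β n ^ 2 / 100 := by
  have h := eventually_logRate_succ β (show (0 : ℝ) < 1 / 1000 by norm_num)
  filter_upwards [h, (tendsto_add_atTop_nat 1).eventually h, eventually_logRate_pos β,
    (tendsto_add_atTop_nat 1).eventually (eventually_logRate_pos β),
    eventually_one_div_sq_le β (show (0 : ℝ) < 1 / 1000 by norm_num), eventually_gt_atTop 0,
    (tendsto_logRate β).eventually_le_const (show (0 : ℝ) < 1 by norm_num)]
    with n h1 h2 h3 h4 h5 h0 h6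
  have h0' : (0 : ℝ) < n := by exact_mod_cast h0
  set a := logRate β n
  set b := logRate β (n + 1)
  set c := logRate β (n + 1 + 1)
  have hs : (0 : ℝ) < 1 / n := by positivity
  have hb : b ≤ 2 * a := by
    rw [abs_le] at h1
    nlinarith
  have e : c - a * (1 - 2 * (1 / n)) =
      (c - b * (1 - 1 / ((n + 1 : ℕ) : ℝ))) + (b - a * (1 - 1 / n)) * (n / (n + 1)) +
        a * (2 * (1 / n * (1 / (n + 1)))) := by
    push_cast
    field_simp
    ring
  have a1 : |(b - a * (1 - 1 / n)) * (n / (n + 1))| ≤ 1 / 1000 * a ^ 2 := by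
    rw [abs_mul]
    refine le_trans (mul_le_of_le_one_right (abs_nonneg _) ?_) h1
    rw [abs_of_nonneg (by positivity), div_le_one (by positivity)]
    linarith
  have a2 : |a * (2 * (1 / n * (1 / (n + 1))))| ≤ 2 / 1000 * a ^ 2 := by
    rw [abs_of_pos (by positivity)]
    calc a * (2 * (1 / n * (1 / (n + 1)))) ≤ a * (2 * (1 / n * (1 / n))) := by
          gcongr; linarith
      _ = 2 * a * (1 / (n : ℝ)) ^ 2 := by ring
      _ ≤ 2 * a * (1 / 1000 * a) := by gcongr
      _ = _ := by ring
  change |c - a * (1 - 2 * (1 / n))| ≤ a ^ 2 / 100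
  rw [e]
  refine (abs_add_le _ _).trans ?_
  have := abs_add_le (c - b * (1 - 1 / ((n + 1 : ℕ) : ℝ))) ((b - a * (1 - 1 / n)) * (n / (n + 1)))
  nlinarith

theorem upProb_perturbation_eq {β : ℝ} {n : ℕ} (hn : 4 ≤ n) (hl : 0 ≤ Real.log (Real.log n)) :
    upProb (perturbation β) n = 1 / 3 * (1 + 1 / n + logRate β n) := by
  rw [upProb, if_neg (by omega), perturbation, if_neg (by omega), logRate, slowFactor,
    Real.rpow_neg hl]
  have : (n : ℝ) ≠ 0 := by positivity
  by_cases hz : Real.log (Real.log n) ^ β = 0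
  · simp [hz]; ring
  · field_simp; ring

theorem exists_rateBounds (β : ℝ) :
    ∃ N, RateBounds (upProb (perturbation β)) (logRate β) N := by
  have hev : ∀ᶠ n : ℕ in atTop, 0 < logRate β n ∧ logRate β n ≤ 1 / 100 ∧ (1 / n : ℝ) ≤ 1 / 100 ∧
      upProb (perturbation β) n = 1 / 3 * (1 + 1 / n + logRate β n) ∧
      |logRate β (n + 1) - logRate β n * (1 - 1 / n)| ≤ logRate β n ^ 2 / 100 ∧
      |logRate β (n + 2) - logRate β n * (1 - 2 * (1 / n))| ≤ logRate β n ^ 2 / 100 ∧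
      (1 / n : ℝ) ^ 2 ≤ logRate β n / 100 := by
    filter_upwards [eventually_logRate_pos β,
      (tendsto_logRate β).eventually_le_const (show (0 : ℝ) < 1 / 100 by norm_num),
      (tendsto_one_div_atTop_nhds_zero_nat (𝕜 := ℝ)).eventually_le_const
        (show (0 : ℝ) < 1 / 100 by norm_num),
      tendsto_loglog_nat.eventually_ge_atTop 0, eventually_ge_atTop 4,
      eventually_logRate_succ β (show (0 : ℝ) < 1 / 100 by norm_num),
      eventually_logRate_add_two β,
      eventually_one_div_sq_le β (show (0 : ℝ) < 1 / 100 by norm_num)]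
      with n h1 h2 h3 h4 h5 h6 h7 h8
    exact ⟨h1, h2, h3, upProb_perturbation_eq h5 h4, by linarith, h7, by linarith⟩
  obtain ⟨N, hN⟩ := eventually_atTop.1 hev
  refine ⟨N, fun n hn => (hN n hn).1, fun n hn => ?_, fun n hn => ?_, fun n hn => ?_,
    fun n hn => ?_, fun n hn => ?_⟩ <;>
    obtain ⟨h1, h2, h3, h4, h5, h6, h7⟩ := hN n hn <;>
    have hs : (0 : ℝ) ≤ 1 / n := by positivity
  · linarith
  · rw [h4]; linarith
  · rw [h4]; linarith
  · rw [h4]; exact super_of_rate h1 hs h5 h6 h7 h3 h2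
  · rw [h4]; exact sub_of_rate h1 hs h5 h6 h3 h2

/-- On `[j, j²]` the logarithm at most doubles, so `log log` grows by at most `log 2` and also at
most doubles. -/
theorem exists_slowFactor_comparable (β : ℝ) : ∃ C : ℝ, 1 ≤ C ∧ ∀ᶠ j : ℕ in atTop,
    ∀ k, j ≤ k → k ≤ j ^ 2 →
      slowFactor β k ≤ C * slowFactor β j ∧ slowFactor β j ≤ C * slowFactor β k := by
  refine ⟨2 ^ |β|, Real.one_le_rpow (by norm_num) (abs_nonneg β), ?_⟩
  filter_upwards [tendsto_log_nat.eventually_ge_atTop 1,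
    tendsto_loglog_nat.eventually_ge_atTop 1, eventually_gt_atTop 0] with j h1 h2 h0 k hjk hkj
  have h0' : (0 : ℝ) < j := by exact_mod_cast h0
  have hjk' : (j : ℝ) ≤ k := by exact_mod_cast hjk
  have hkj' : (k : ℝ) ≤ (j : ℝ) ^ 2 := by exact_mod_cast hkj
  have l1 : Real.log j ≤ Real.log k := Real.log_le_log h0' hjk'
  have l2 : Real.log k ≤ 2 * Real.log j := by
    refine (Real.log_le_log (by linarith) hkj').trans (le_of_eq ?_)
    rw [Real.log_pow]; norm_num
  set a := Real.log (Real.log j)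
  set b := Real.log (Real.log k) with hb
  have ab : a ≤ b := Real.log_le_log (by linarith) l1
  have ba : b ≤ 2 * a := by
    have : b ≤ Real.log (2 * Real.log j) := Real.log_le_log (by linarith) l2
    rw [Real.log_mul (by norm_num) (by linarith)] at this
    have h3 : Real.log 2 ≤ 1 := (Real.log_le_sub_one_of_pos (by norm_num)).trans (by norm_num)
    linarith
  have hu1 : 1 ≤ b / a := by rw [le_div_iff₀ (by linarith)]; linarith
  have hu2 : b / a ≤ 2 := by rw [div_le_iff₀ (by linarith)]; linarith
  have hupper : ∀ s : ℝ, |s| = |β| → (b / a) ^ s ≤ 2 ^ |β| := fun s hs => by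
    calc (b / a) ^ s ≤ (b / a) ^ |s| := Real.rpow_le_rpow_of_exponent_le hu1 (le_abs_self s)
      _ ≤ 2 ^ |s| := Real.rpow_le_rpow (by linarith) hu2 (abs_nonneg s)
      _ = _ := by rw [hs]
  have hSa : 0 < slowFactor β j := Real.rpow_pos_of_pos (by linarith) _
  have hSb : 0 < slowFactor β k := Real.rpow_pos_of_pos (by linarith) _
  have e : slowFactor β k = (b / a) ^ (-β) * slowFactor β j := by
    rw [Real.div_rpow (by linarith) (by linarith)]
    unfold slowFactor at hSa ⊢
    rw [div_mul_cancel₀ _ hSa.ne']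
  have e' : slowFactor β j = (b / a) ^ β * slowFactor β k := by
    rw [e, ← mul_assoc, ← Real.rpow_add (by linarith)]
    simp
  constructor
  · rw [e]
    exact mul_le_mul_of_nonneg_right (hupper _ (abs_neg β)) hSa.le
  · nth_rewrite 1 [e']
    exact mul_le_mul_of_nonneg_right (hupper _ rfl) hSb.le

theorem log_le_sum_Ioc {a b : ℕ} (hab : a ≤ b) :
    Real.log (b + 1) - Real.log (a + 1) ≤ ∑ i ∈ Finset.Ioc a b, 1 / (i : ℝ) := by
  induction b, hab using Nat.le_induction with
  | base => simp
  | succ n hn ih =>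
    rw [← Finset.insert_Ioc_right_eq_Ioc_add_one hn, Finset.sum_insert (by simp)]
    have h : Real.log ((n + 1 : ℕ) + 1) - Real.log (n + 1) ≤ 1 / ((n + 1 : ℕ) : ℝ) := by
      rw [← Real.log_div (by positivity) (by positivity)]
      refine (Real.log_le_sub_one_of_pos (by positivity)).trans (le_of_eq ?_)
      push_cast
      field_simp
      ring
    linarith

theorem sum_Ioc_le_log {a b : ℕ} (ha : 0 < a) (hab : a ≤ b) :
    ∑ i ∈ Finset.Ioc a b, 1 / (i : ℝ) ≤ Real.log b - Real.log a := by
  induction b, hab using Nat.le_induction with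
  | base => simp
  | succ n hn ih =>
    have hn0 : (0 : ℝ) < n := by exact_mod_cast (by omega : 0 < n)
    rw [← Finset.insert_Ioc_right_eq_Ioc_add_one hn, Finset.sum_insert (by simp)]
    have h : 1 / ((n + 1 : ℕ) : ℝ) ≤ Real.log ((n + 1 : ℕ) : ℝ) - Real.log n := by
      have h1 : Real.log ((n : ℝ) / (n + 1 : ℕ)) ≤ (n : ℝ) / (n + 1 : ℕ) - 1 :=
        Real.log_le_sub_one_of_pos (by positivity)
      rw [Real.log_div (by positivity) (by positivity)] at h1
      have h2 : (n : ℝ) / (n + 1 : ℕ) - 1 = -(1 / ((n + 1 : ℕ) : ℝ)) := by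
        push_cast
        field_simp
        ring
      linarith
    linarith

/-- The sum is at least of order `slowFactor β j * log j`. Its divergence means that from `j²` the
walk is unlikely to return to `j`, so `j²` separates near from far pairs. -/
theorem tendsto_sum_logRate (β : ℝ) :
    Tendsto (fun j : ℕ => ∑ i ∈ Finset.Ioc j (j ^ 2), logRate β i) atTop atTop := by
  obtain ⟨C, hC, hcomp⟩ := exists_slowFactor_comparable β
  have h1 := (tendsto_slowFactor_mul_log β).const_mul_atTop (show 0 < 1 / (2 * C) by positivity)
  refine tendsto_atTop_mono' _ ?_ h1
  filter_upwards [hcomp, eventually_slowFactor_pos β, eventually_ge_atTop 2,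
    tendsto_log_nat.eventually_ge_atTop 2] with j hj hpos h2 hlog
  have hj0 : (2 : ℝ) ≤ j := by exact_mod_cast h2
  have hsum := log_le_sum_Ioc (show j ≤ j ^ 2 by nlinarith)
  have hl1 : Real.log ((j : ℝ) ^ 2) ≤ Real.log (((j ^ 2 : ℕ) : ℝ) + 1) :=
    Real.log_le_log (by positivity) (by push_cast; linarith)
  rw [Real.log_pow] at hl1
  have hl2 : Real.log ((j : ℝ) + 1) ≤ Real.log 2 + Real.log j := by
    rw [← Real.log_mul (by norm_num) (by positivity)]
    exact Real.log_le_log (by positivity) (by linarith)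
  have hlog2 : Real.log 2 ≤ 1 := (Real.log_le_sub_one_of_pos (by norm_num)).trans (by norm_num)
  have hhalf : 1 / 2 * Real.log j ≤ ∑ i ∈ Finset.Ioc j (j ^ 2), 1 / (i : ℝ) := by
    push_cast at hl1 hsum
    linarith
  calc 1 / (2 * C) * (slowFactor β j * Real.log j)
      = 1 / C * slowFactor β j * (1 / 2 * Real.log j) := by field_simp
    _ ≤ 1 / C * slowFactor β j * ∑ i ∈ Finset.Ioc j (j ^ 2), 1 / (i : ℝ) := by
        gcongr
    _ = ∑ i ∈ Finset.Ioc j (j ^ 2), 1 / C * slowFactor β j * (1 / (i : ℝ)) := by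
        rw [Finset.mul_sum]
    _ ≤ ∑ i ∈ Finset.Ioc j (j ^ 2), logRate β i := by
        refine Finset.sum_le_sum fun i hi => ?_
        have hi' := Finset.mem_Ioc.1 hi
        have := (hj i hi'.1.le hi'.2).2
        have hle : 1 / C * slowFactor β j ≤ slowFactor β i := by
          rw [one_div, inv_mul_le_iff₀ (by linarith)]
          exact this
        unfold logRate
        rw [mul_one_div]
        gcongr

theorem exists_logRate_comparable (β : ℝ) : ∃ C : ℝ, 1 ≤ C ∧ ∀ᶠ j : ℕ in atTop,
    (∀ k, j ≤ k → k ≤ j ^ 2 → logRate β k ≤ C * logRate β j) ∧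
    (∀ k, j ≤ k → k ≤ 4 * j → logRate β j ≤ C * logRate β k) := by
  obtain ⟨C, hC, hcomp⟩ := exists_slowFactor_comparable β
  refine ⟨4 * C, by linarith, ?_⟩
  filter_upwards [hcomp, eventually_ge_atTop 4, eventually_slowFactor_pos β] with j hj h4 hpos
  have hj0 : (0 : ℝ) < j := by positivity
  constructor
  · intro k hjk hk
    have hjk' : (j : ℝ) ≤ k := by exact_mod_cast hjk
    have := (hj k hjk hk).1
    calc logRate β k ≤ C * slowFactor β j / k := by unfold logRate; gcongr
      _ ≤ C * slowFactor β j / j := by gcongr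
      _ = C * logRate β j := by unfold logRate; ring
      _ ≤ 4 * C * logRate β j := by
          have : 0 < logRate β j := div_pos hpos hj0
          nlinarith
  · intro k hjk hk
    have hjk' : (j : ℝ) ≤ k := by exact_mod_cast hjk
    have hk' : (k : ℝ) ≤ 4 * j := by exact_mod_cast hk
    have h1 := (hj k hjk (by nlinarith)).2
    unfold logRate
    rw [div_le_iff₀ hj0]
    have hS : 0 < slowFactor β k := by nlinarith
    have hk0 : (0 : ℝ) < k := by linarith
    calc slowFactor β j ≤ C * slowFactor β k := h1
      _ = C * (slowFactor β k / k) * k := by field_simp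
      _ ≤ C * (slowFactor β k / k) * (4 * j) := by gcongr
      _ = _ := by ring

/-! ### Order of magnitude of the escape probability. -/

section Escape

variable {β : ℝ} {Q : ℕ → Measure (ℕ → ℕ)}

/-- For the upper bound take the window `(j, j²]`: its rate sum `s` is at least one, so `(1 + 2 s) /
s ≤ 3`. -/
theorem exists_escProb_comparable (h : IsWalkFamily (upProb (perturbation β)) Q) :
    ∃ C : ℝ, 1 ≤ C ∧ ∀ᶠ j : ℕ in atTop,
      escProb Q j ≤ C * logRate β j ∧ logRate β j ≤ C * escProb Q j := by
  obtain ⟨C, hC, hcomp⟩ := exists_logRate_comparable β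
  obtain ⟨N, hN⟩ := exists_rateBounds β
  refine ⟨3 * C, by linarith, ?_⟩
  filter_upwards [hcomp, eventually_ge_atTop N, eventually_ge_atTop 2,
    (tendsto_sum_logRate β).eventually_ge_atTop 1] with j hj hjN h2 hs
  have h1 := hN.escProb_mul_sum_le h hjN (show j < j ^ 2 by nlinarith)
  have h3 := hj.1 (j + 1) (by omega) (by nlinarith)
  have h4 := hj.2 (j + 1) (by omega) (by omega)
  have h5 := hN.le_escProb h hjN
  have h6 := hN.pos (j + 1) (by omega)
  have h7 := hN.pos j hjN
  have h8 := hN.escProb_pos h hjN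
  constructor
  · by_contra! hlt
    nlinarith
  · nlinarith

end Escape

/-! ### Finitely many skipped points for `β > 1` -/

/-- The event that `k` is the last skipped site below `K`. -/
def lastSkipEvent (k K : ℕ) : Set (ℕ → ℕ) :=
  skipEvent k ∩ ⋂ i ∈ Finset.Ioo k K, (skipEvent i)ᶜ

theorem measurableSet_lastSkipEvent (k K : ℕ) : MeasurableSet (lastSkipEvent k K) :=
  (measurableSet_skipEvent k).inter
    (Finset.measurableSet_biInter _ fun i _ => (measurableSet_skipEvent i).compl)

theorem preimage_consPath_lastSkipEvent {x k : ℕ} (K : ℕ) (hx : x < k) :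
    consPath x ⁻¹' lastSkipEvent k K = lastSkipEvent k K := by
  unfold lastSkipEvent
  rw [Set.preimage_inter, preimage_consPath_skipEvent hx.ne, Set.preimage_iInter₂]
  congr 1
  refine Set.iInter₂_congr fun i hi => ?_
  rw [Set.preimage_compl, preimage_consPath_skipEvent (by have := Finset.mem_Ioo.1 hi; omega)]

theorem disjoint_lastSkipEvent {k k' K : ℕ} (hkk : k < k') (hK : k' < K) :
    Disjoint (lastSkipEvent k K) (lastSkipEvent k' K) := by
  refine Set.disjoint_left.2 fun ω h1 h2 => ?_
  have := Set.mem_iInter₂.1 h1.2 k' (Finset.mem_Ioo.2 ⟨hkk, hK⟩)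
  exact this h2.1

theorem exists_lastSkipEvent {a K : ℕ} {ω : ℕ → ℕ} (h : ∃ k ∈ Finset.Ico a K, ω ∈ skipEvent k) :
    ∃ k ∈ Finset.Ico a K, ω ∈ lastSkipEvent k K := by
  classical
  let s := (Finset.Ico a K).filter fun k => ω ∈ skipEvent k
  obtain ⟨k, hk, hω⟩ := h
  have hs : s.Nonempty := ⟨k, Finset.mem_filter.2 ⟨hk, hω⟩⟩
  have hm := Finset.mem_filter.1 (s.max'_mem hs)
  refine ⟨s.max' hs, hm.1, hm.2, Set.mem_iInter₂.2 fun i hi hωi => ?_⟩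
  have hi' := Finset.mem_Ioo.1 hi
  have hm1 := Finset.mem_Ico.1 hm.1
  have : i ≤ s.max' hs :=
    s.le_max' i (Finset.mem_filter.2 ⟨Finset.mem_Ico.2 ⟨by omega, hi'.2⟩, hωi⟩)
  omega

section Finite

variable {β : ℝ} {Q : ℕ → Measure (ℕ → ℕ)}

/-- Getting over `j` from `x` costs a factor `18`. Climbing from `j + 1` past `k` before `j` has
chance at least a constant over `k - j`, as the rates on the window are at most `C` times the first
one. Above `k`, skipping `k` already implies skipping `j`. The second `18` comes from getting over
`k`. -/
theorem exists_le_real_skip_inter_lastSkip (h : IsWalkFamily (upProb (perturbation β)) Q) :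
    ∃ C : ℝ, 1 ≤ C ∧ ∀ᶠ j : ℕ in atTop, ∀ x k K, x < j → j + 3 < k → k ≤ 4 * j →
      (Q x).real (lastSkipEvent k K) / (k - j) ≤
        C * (Q x).real (skipEvent j ∩ lastSkipEvent k K) := by
  obtain ⟨C, hC, hcomp⟩ := exists_logRate_comparable β
  obtain ⟨N, hN⟩ := exists_rateBounds β
  refine ⟨324 * C, by linarith, ?_⟩
  filter_upwards [(tendsto_add_atTop_nat 1).eventually hcomp, eventually_ge_atTop (N + 4)]
    with j hj hjN x k K hx hjk hk4
  have hjk' : (j : ℝ) < k := by exact_mod_cast (by omega : j < k)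
  have hDm : MeasurableSet (skipEvent j ∩ lastSkipEvent k K) :=
    (measurableSet_skipEvent j).inter (measurableSet_lastSkipEvent k K)
  have hDc : ∀ y, y ≠ j → y < k →
      consPath y ⁻¹' (skipEvent j ∩ lastSkipEvent k K) = skipEvent j ∩ lastSkipEvent k K :=
    fun y hy hyk => by
      rw [Set.preimage_inter, preimage_consPath_skipEvent hy, preimage_consPath_lastSkipEvent K hyk]
  obtain ⟨j', rfl⟩ : ∃ j', j = j' + 3 := ⟨j - 3, by omega⟩
  obtain ⟨k', rfl⟩ : ∃ k', k = k' + 3 := ⟨k - 3, by omega⟩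
  have h1 := h.le_real_of_skip (j := j') (x := x) hDm (fun y hy => hDc y hy.ne (by omega))
    (fun n hn _ => ⟨hN.p_lower n (by omega), (hN.p_upper n (by omega)).trans (by norm_num)⟩)
    (by omega)
  have h2 := hN.le_real_mul_sum h (j := j' + 3) (k := k') hDm
    (fun y hy hyk => hDc y hy.ne' hyk)
    (h.real_eq_zero_of_subset_skipEvent Set.inter_subset_left) (by omega) (by omega)
  have h3 : (Q (k' + 4)).real (skipEvent (j' + 3) ∩ lastSkipEvent (k' + 3) K) =
      (Q (k' + 4)).real (lastSkipEvent (k' + 3) K) :=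
    h.skipEvent_above (by omega) (by omega) _
  have h4 : (Q x).real (lastSkipEvent (k' + 3) K) ≤ (Q (k' + 4)).real (lastSkipEvent (k' + 3) K) :=
    h.real_le_of_skip (measurableSet_lastSkipEvent _ _) Set.inter_subset_left
      (fun y hy => preimage_consPath_lastSkipEvent K hy) (by omega)
  have h5 : ∑ i ∈ Finset.Ioc (j' + 3) (k' + 2), logRate β i ≤
      (((k' + 3 : ℕ) : ℝ) - ((j' + 3 : ℕ) : ℝ)) * (C * logRate β (j' + 3 + 1)) := by
    calc ∑ i ∈ Finset.Ioc (j' + 3) (k' + 2), logRate β i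
        ≤ ∑ i ∈ Finset.Ioc (j' + 3) (k' + 2), C * logRate β (j' + 3 + 1) := by
          refine Finset.sum_le_sum fun i hi => ?_
          have := Finset.mem_Ioc.1 hi
          exact hj.1 i (by omega) (by nlinarith)
      _ ≤ _ := by
          rw [Finset.sum_const, nsmul_eq_mul, Nat.card_Ioc]
          have ht := hN.pos (j' + 3 + 1) (by omega)
          gcongr
          rw [Nat.cast_sub (by omega)]
          push_cast
          linarith
  have ht := hN.pos (j' + 3 + 1) (by omega)
  rw [h3] at h2
  set A := (Q (k' + 4)).real (lastSkipEvent (k' + 3) K)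
  set B := (Q (j' + 3 + 1)).real (skipEvent (j' + 3) ∩ lastSkipEvent (k' + 3) K)
  have hB : 0 ≤ B := measureReal_nonneg
  have h6 : A / 18 ≤ B * ((((k' + 3 : ℕ) : ℝ) - ((j' + 3 : ℕ) : ℝ)) * C) := by
    have := h2.trans (mul_le_mul_of_nonneg_left h5 hB)
    refine le_of_mul_le_mul_right ?_ ht
    linarith
  rw [div_le_iff₀ (by linarith)]
  have h7 : B / 18 ≤ (Q x).real (skipEvent (j' + 3) ∩ lastSkipEvent (k' + 3) K) := h1
  have h8 : 0 ≤ (((k' + 3 : ℕ) : ℝ) - ((j' + 3 : ℕ) : ℝ)) * C := by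
    apply mul_nonneg <;> linarith
  nlinarith [mul_le_mul_of_nonneg_right h7 h8]

/-- Double counting of pairs `(j, k)` with `j` skipped and `k` the last skipped site below `4a`. The
last site is used because it makes the events disjoint in `k`, yet depends only on sites from `k`
on. -/
theorem exists_real_block_le (h : IsWalkFamily (upProb (perturbation β)) Q) (x : ℕ) :
    ∃ C : ℝ, 1 ≤ C ∧ ∀ᶠ a : ℕ in atTop,
      (Q x).real (⋃ k ∈ Finset.Ico (2 * a) (4 * a), skipEvent k) ≤
        C * (slowFactor β a / Real.log a) := by
  have hP := h.isProbabilityMeasure x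
  obtain ⟨C₁, hC₁, hlow⟩ := exists_le_real_skip_inter_lastSkip h
  obtain ⟨C₂, hC₂, hesc⟩ := exists_escProb_comparable h
  obtain ⟨C₃, hC₃, hcomp⟩ := exists_logRate_comparable β
  refine ⟨2 * C₁ * (3 * (C₂ * C₃)), ?_, ?_⟩
  · have : 1 ≤ C₂ * C₃ := one_le_mul_of_one_le_of_one_le hC₂ hC₃
    nlinarith
  obtain ⟨N₁, hN₁⟩ := eventually_atTop.1 hlow
  obtain ⟨N₂, hN₂⟩ := eventually_atTop.1 hesc
  filter_upwards [hcomp, eventually_ge_atTop N₁, eventually_ge_atTop N₂, eventually_gt_atTop x,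
    eventually_ge_atTop 4, tendsto_log_nat.eventually_ge_atTop (2 * Real.log 4),
    tendsto_log_nat.eventually_ge_atTop 1, eventually_logRate_pos β]
    with a hcomp haN₁ haN₂ hax ha4 hlog hlog1 htpos
  have ha0 : (0 : ℝ) < a := by positivity
  set f : ℕ → ℕ → ℝ := fun j k => (Q x).real (skipEvent j ∩ lastSkipEvent k (4 * a))
  set g : ℕ → ℝ := fun k => (Q x).real (lastSkipEvent k (4 * a))
  have hf0 : ∀ j k, 0 ≤ f j k := fun j k => measureReal_nonneg
  have hg0 : ∀ k, 0 ≤ g k := fun k => measureReal_nonneg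
  have hunion : (Q x).real (⋃ k ∈ Finset.Ico (2 * a) (4 * a), skipEvent k) ≤
      ∑ k ∈ Finset.Ico (2 * a) (4 * a), g k := by
    refine le_trans (h.real_mono x (E := ⋃ k ∈ Finset.Ico (2 * a) (4 * a),
      lastSkipEvent k (4 * a)) (fun ω hω => ?_)) (measureReal_biUnion_finset_le _ _)
    simp only [Set.mem_iUnion, exists_prop] at hω ⊢
    exact exists_lastSkipEvent hω
  -- Sum over `j = k - d` with `3 < d ≤ a`. These `j` stay in `[a, 4a)`, and the harmonic sum is at
  -- least `log a / 2` once `log a ≥ 2 log 4`.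
  have hharm : ∀ k ∈ Finset.Ico (2 * a) (4 * a),
      g k * (1 / 2 * Real.log a) ≤ C₁ * ∑ j ∈ Finset.Ico a (4 * a), f j k := by
    intro k hk
    have hk' := Finset.mem_Ico.1 hk
    have hsum : 1 / 2 * Real.log a ≤ ∑ d ∈ Finset.Ioc 3 a, 1 / (d : ℝ) := by
      have h1 := log_le_sum_Ioc (show 3 ≤ a by omega)
      have h2 : Real.log a ≤ Real.log (a + 1) := Real.log_le_log ha0 (by linarith)
      norm_num at h1
      norm_num
      linarith
    calc g k * (1 / 2 * Real.log a) ≤ g k * ∑ d ∈ Finset.Ioc 3 a, 1 / (d : ℝ) :=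
          mul_le_mul_of_nonneg_left hsum (hg0 k)
      _ = ∑ d ∈ Finset.Ioc 3 a, g k * (1 / (d : ℝ)) := by rw [Finset.mul_sum]
      _ ≤ ∑ d ∈ Finset.Ioc 3 a, C₁ * f (k - d) k := by
          refine Finset.sum_le_sum fun d hd => ?_
          have hd' := Finset.mem_Ioc.1 hd
          have := hN₁ (k - d) (by omega) x k (4 * a) (by omega) (by omega) (by omega)
          rw [Nat.cast_sub (by omega), sub_sub_cancel] at this
          rwa [mul_one_div]
      _ = C₁ * ∑ j ∈ (Finset.Ioc 3 a).image (fun d => k - d), f j k := by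
          rw [← Finset.mul_sum, Finset.sum_image]
          intro d hd d' hd' hdd
          have hd1 := Finset.mem_Ioc.1 hd
          have hd2 := Finset.mem_Ioc.1 hd'
          simp only at hdd
          omega
      _ ≤ C₁ * ∑ j ∈ Finset.Ico a (4 * a), f j k := by
          refine mul_le_mul_of_nonneg_left ?_ (by linarith)
          refine Finset.sum_le_sum_of_subset_of_nonneg (fun j hj => ?_) fun j _ _ => hf0 j k
          obtain ⟨d, hd, rfl⟩ := Finset.mem_image.1 hj
          have hd' := Finset.mem_Ioc.1 hd
          exact Finset.mem_Ico.2 ⟨by omega, by omega⟩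
  -- For fixed `j` the events are disjoint in `k`, so the row sum is at most the probability of
  -- skipping `j`.
  have hrow : ∀ j ∈ Finset.Ico a (4 * a),
      ∑ k ∈ Finset.Ico (2 * a) (4 * a), f j k ≤ C₂ * C₃ * logRate β a := by
    intro j hj
    have hj' := Finset.mem_Ico.1 hj
    have h1 : ∑ k ∈ Finset.Ico (2 * a) (4 * a), f j k ≤ skipProb Q j x := by
      rw [← measureReal_biUnion_finset]
      · refine measureReal_mono (Set.iUnion₂_subset fun k _ => Set.inter_subset_left)
      · intro k hk k' hk' hkk
        have hk1 := Finset.mem_Ico.1 hk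
        have hk2 := Finset.mem_Ico.1 hk'
        rcases lt_or_gt_of_ne hkk with hlt | hlt
        · exact (disjoint_lastSkipEvent hlt hk2.2).mono Set.inter_subset_right
            Set.inter_subset_right
        · exact ((disjoint_lastSkipEvent hlt hk1.2).mono Set.inter_subset_right
            Set.inter_subset_right).symm
      · exact fun k _ => (measurableSet_skipEvent j).inter (measurableSet_lastSkipEvent k _)
    have h2 : skipProb Q j x ≤ escProb Q j :=
      h.real_le_of_skip (measurableSet_skipEvent j) subset_rfl
        (fun y hy => preimage_consPath_skipEvent hy.ne) (by omega)
    have h3 := (hN₂ j (by omega)).1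
    have h4 := hcomp.1 j hj'.1 (by nlinarith)
    calc _ ≤ _ := h1
      _ ≤ _ := h2
      _ ≤ _ := h3
      _ ≤ C₂ * (C₃ * logRate β a) := by gcongr
      _ = _ := by ring
  have htot : (∑ k ∈ Finset.Ico (2 * a) (4 * a), g k) * (1 / 2 * Real.log a) ≤
      C₁ * (3 * (C₂ * C₃) * slowFactor β a) := by
    calc (∑ k ∈ Finset.Ico (2 * a) (4 * a), g k) * (1 / 2 * Real.log a)
        = ∑ k ∈ Finset.Ico (2 * a) (4 * a), g k * (1 / 2 * Real.log a) := by rw [Finset.sum_mul]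
      _ ≤ ∑ k ∈ Finset.Ico (2 * a) (4 * a), C₁ * ∑ j ∈ Finset.Ico a (4 * a), f j k :=
          Finset.sum_le_sum hharm
      _ = C₁ * ∑ j ∈ Finset.Ico a (4 * a), ∑ k ∈ Finset.Ico (2 * a) (4 * a), f j k := by
          rw [← Finset.mul_sum, Finset.sum_comm]
      _ ≤ C₁ * ∑ j ∈ Finset.Ico a (4 * a), C₂ * C₃ * logRate β a :=
          mul_le_mul_of_nonneg_left (Finset.sum_le_sum hrow) (by linarith)
      _ = C₁ * (3 * (C₂ * C₃) * slowFactor β a) := by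
          rw [Finset.sum_const, nsmul_eq_mul, Nat.card_Ico, show 4 * a - a = 3 * a by omega, logRate]
          push_cast
          field_simp
  refine hunion.trans ?_
  rw [← mul_div_assoc, le_div_iff₀ (by linarith)]
  linarith

theorem summable_log_rpow_div {β : ℝ} (hβ : 1 < β) :
    Summable fun m : ℕ => Real.log (m + 2 : ℕ) ^ (-β) / (m + 2 : ℕ) := by
  have hl : ∀ m : ℕ, 0 < Real.log ((m + 2 : ℕ) : ℝ) := fun m =>
    Real.log_pos (by push_cast; linarith [(Nat.cast_nonneg m : (0 : ℝ) ≤ m)])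
  refine (summable_condensed_iff_of_nonneg (fun m => ?_) (fun m n _ hmn => ?_)).1 ?_
  · have := hl m
    positivity
  · have h1 : ((m + 2 : ℕ) : ℝ) ≤ ((n + 2 : ℕ) : ℝ) := by exact_mod_cast (by omega)
    have h2 : Real.log ((n + 2 : ℕ) : ℝ) ^ (-β) ≤ Real.log ((m + 2 : ℕ) : ℝ) ^ (-β) :=
      Real.rpow_le_rpow_of_nonpos (hl m) (Real.log_le_log (by positivity) h1) (by linarith)
    have h3 := Real.rpow_nonneg (hl m).le (-β)
    gcongr
  · have hs : Summable fun k : ℕ => Real.log 2 ^ (-β) * (1 / (k : ℝ) ^ β) :=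
      (Real.summable_one_div_nat_rpow.2 hβ).mul_left _
    refine Summable.of_norm_bounded_eventually_nat hs ?_
    filter_upwards [eventually_ge_atTop 1] with k hk
    have hk0 : (0 : ℝ) < k := by exact_mod_cast hk
    have hlog2 : 0 < Real.log 2 := Real.log_pos (by norm_num)
    have h2k : (0 : ℝ) < 2 ^ k := by positivity
    have hL := hl (2 ^ k)
    rw [Real.norm_of_nonneg (by positivity)]
    have h1 : k * Real.log 2 ≤ Real.log ((2 ^ k + 2 : ℕ) : ℝ) := by
      rw [← Real.log_pow]
      exact Real.log_le_log h2k (by push_cast; linarith)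
    have h2 : Real.log ((2 ^ k + 2 : ℕ) : ℝ) ^ (-β) ≤ (k * Real.log 2) ^ (-β) :=
      Real.rpow_le_rpow_of_nonpos (by positivity) h1 (by linarith)
    calc (2 : ℝ) ^ k * (Real.log ((2 ^ k + 2 : ℕ) : ℝ) ^ (-β) / ((2 ^ k + 2 : ℕ) : ℝ))
        ≤ 2 ^ k * ((k * Real.log 2) ^ (-β) / 2 ^ k) := by
          gcongr
          push_cast
          linarith
      _ = (k * Real.log 2) ^ (-β) := by field_simp
      _ = Real.log 2 ^ (-β) * (1 / (k : ℝ) ^ β) := by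
          rw [Real.mul_rpow hk0.le hlog2.le, Real.rpow_neg hk0.le β]
          ring

theorem summable_slowFactor_two_pow {β : ℝ} (hβ : 1 < β) :
    Summable fun m : ℕ => slowFactor β (2 ^ m) / Real.log ((2 ^ m : ℕ) : ℝ) := by
  have hs : Summable fun m : ℕ => (2 ^ β * 2) * (Real.log (m : ℕ) ^ (-β) / (m : ℕ)) := by
    refine Summable.mul_left _ ?_
    exact (summable_nat_add_iff 2).1 (summable_log_rpow_div hβ)
  refine Summable.of_norm_bounded_eventually_nat hs ?_
  filter_upwards [eventually_ge_atTop 4] with m hm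
  have hm4 : (4 : ℝ) ≤ m := by exact_mod_cast hm
  have hlog2 : 1 / 2 ≤ Real.log 2 := by linarith [Real.log_two_gt_d9]
  have hlogm : 0 < Real.log m := Real.log_pos (by linarith)
  have e : Real.log ((2 ^ m : ℕ) : ℝ) = m * Real.log 2 := by push_cast; rw [Real.log_pow]
  have h1 : 1 / 2 * Real.log m ≤ Real.log (m * Real.log 2) := by
    -- Since `m ≥ 4` and `log 2 ≥ 1/2`, `(m log 2)² ≥ m² / 4 ≥ m`.
    have h2 : Real.log m ≤ Real.log ((m * Real.log 2) ^ 2) := by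
      refine Real.log_le_log (by linarith) ?_
      have : (m : ℝ) / 2 ≤ m * Real.log 2 := by nlinarith
      nlinarith
    rw [Real.log_pow] at h2
    push_cast at h2
    linarith
  have h3 : Real.log (m * Real.log 2) ^ (-β) ≤ (1 / 2 * Real.log m) ^ (-β) :=
    Real.rpow_le_rpow_of_nonpos (by positivity) h1 (by linarith)
  have h4 : (1 / 2 * Real.log m) ^ (-β) = 2 ^ β * Real.log m ^ (-β) := by
    rw [Real.mul_rpow (by norm_num) hlogm.le, one_div, Real.inv_rpow (by norm_num),
      Real.rpow_neg (by norm_num), inv_inv]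
  have hll : 0 < Real.log (m * Real.log 2) := lt_of_lt_of_le (by positivity) h1
  rw [slowFactor, e, Real.norm_of_nonneg (by positivity)]
  calc Real.log (m * Real.log 2) ^ (-β) / (m * Real.log 2)
      ≤ (2 ^ β * Real.log m ^ (-β)) / (m * (1 / 2)) := by
        rw [← h4]
        gcongr
    _ = _ := by field_simp

/-- For `β > 1` the walk almost surely skips only finitely many sites. -/
theorem ae_finite_skipped (h : IsWalkFamily (upProb (perturbation β)) Q) (hβ : 1 < β) (x : ℕ) :
    ∀ᵐ ω ∂(Q x), {k | ω ∈ skipEvent k}.Finite := by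
  have hP := h.isProbabilityMeasure x
  obtain ⟨C, hC, hbound⟩ := exists_real_block_le h x
  have hpow : Tendsto (fun m : ℕ => 2 ^ m) atTop atTop :=
    tendsto_pow_atTop_atTop_of_one_lt (by norm_num)
  let s : ℕ → Set (ℕ → ℕ) := fun m => ⋃ k ∈ Finset.Ico (2 * 2 ^ m) (4 * 2 ^ m), skipEvent k
  have hsum : Summable fun m => (Q x).real (s m) := by
    refine Summable.of_norm_bounded_eventually_nat ((summable_slowFactor_two_pow hβ).mul_left C) ?_
    filter_upwards [hpow.eventually hbound] with m hm
    rw [Real.norm_of_nonneg measureReal_nonneg]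
    exact hm
  have hne : ∑' m, (Q x) (s m) ≠ ⊤ := by
    have := hsum.tsum_ofReal_ne_top
    simpa [measureReal_def, ENNReal.ofReal_toReal] using this
  filter_upwards [ae_eventually_notMem hne] with ω hω
  obtain ⟨M, hM⟩ := eventually_atTop.1 hω
  refine (Set.finite_lt_nat (2 * 2 ^ M)).subset fun k hk => ?_
  by_contra hlt
  have hlt' : 2 * 2 ^ M ≤ k := not_lt.1 hlt
  have hk0 : k ≠ 0 := by
    have : 0 < 2 ^ M := by positivity
    omega
  have h1 : 2 ^ Nat.log 2 k ≤ k := Nat.pow_log_le_self 2 hk0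
  have h2 : k < 2 ^ (Nat.log 2 k + 1) := Nat.lt_pow_succ_log_self (by norm_num) k
  have h3 : M + 1 ≤ Nat.log 2 k := by
    refine Nat.le_log_of_pow_le (by norm_num) ?_
    rw [pow_succ]; omega
  -- Block `m` is `[2 ^ (m + 1), 2 ^ (m + 2))`, hence the shift by one.
  obtain ⟨m, hm⟩ : ∃ m, Nat.log 2 k = m + 1 := ⟨Nat.log 2 k - 1, by omega⟩
  rw [hm] at h1 h2
  refine hM m (by omega) ?_
  simp only [s, Set.mem_iUnion, exists_prop]
  refine ⟨k, Finset.mem_Ico.2 ⟨?_, ?_⟩, hk⟩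
  · rw [pow_succ] at h1; omega
  · rw [pow_succ, pow_succ] at h2; omega

end Finite

/-! ### Infinitely many skipped points for `β ≤ 1` -/

section Ratio

variable {p t : ℕ → ℝ} {N : ℕ} {Q : ℕ → Measure (ℕ → ℕ)}

theorem IsWalkFamily.skipProb_le_escProb (h : IsWalkFamily p Q) {k x : ℕ} (hx : x ≤ k + 1) :
    skipProb Q k x ≤ escProb Q k :=
  h.real_le_of_skip (measurableSet_skipEvent k) subset_rfl
    (fun _ hy => preimage_consPath_skipEvent hy.ne) hx

/-- The conditional probability, just below `k + 1`, of jumping over `k + 1` converges to `1 / 2`;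
the numerical bounds suffice here. -/
theorem RateBounds.skipProb_succ_bounds (hr : RateBounds p t N) (h : IsWalkFamily p Q) {m : ℕ}
    (hm : N + 4 ≤ m) :
    1 / 3 * escProb Q (m + 1) ≤ skipProb Q (m + 1) m ∧
      skipProb Q (m + 1) m ≤ 14 / 25 * escProb Q (m + 1) := by
  -- `a m` is the chance that the walk from `m`, on first passing above `m`, jumps over `m + 1`.
  let a : ℕ → ℝ := fun m => skipProb Q (m + 1) m / escProb Q (m + 1)
  have hepos : ∀ m, N ≤ m → 0 < escProb Q m := fun m hm => hr.escProb_pos h hm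
  have ha0 : ∀ m, N ≤ m → 0 ≤ a m := fun m hm =>
    div_nonneg (skipProb_nonneg _ _) (hepos _ (by omega)).le
  have ha1 : ∀ m, N ≤ m → a m ≤ 1 := fun m hm =>
    (div_le_one (hepos _ (by omega))).2 (h.skipProb_le_escProb (by omega))
  -- From `m + 1`, jump over `m + 2` at once, or step down to `m` and come back to `m + 1` without
  -- jumping over it: `a (m+1) = p + (1 - p) * a (m+1) * (1 - a m)`. At `p = 1/3` the fixed point is
  -- `1/2`.
  have hrec : ∀ m, N ≤ m → a (m + 1) * (p (m + 1) + (1 - p (m + 1)) * a m) = p (m + 1) := by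
    intro m hm
    have h1 := h.skipProb_succ_mul_escProb (k := m + 1) (x := m) (by omega)
    have h2 := h.skipProb_harmonic (k := m + 1 + 1) (x := m + 1) (by omega)
    have e1 := hepos (m + 1) (by omega)
    have e2 := hepos (m + 1 + 1) (by omega)
    simp only [walkAvg, Nat.add_sub_cancel] at h2
    change _ = p (m + 1) * escProb Q (m + 1 + 1) + _ at h2
    simp only [a]
    field_simp
    have h3 : skipProb Q (m + 1 + 1) m * escProb Q (m + 1) * (1 - p (m + 1)) = skipProb Q (m + 1 + 1) (m + 1) *
        (escProb Q (m + 1) - skipProb Q (m + 1) m) * (1 - p (m + 1)) := by rw [h1]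
    linear_combination escProb Q (m + 1) * h2 + h3
  have hp : ∀ m, N ≤ m → 1 / 3 ≤ p m ∧ p m ≤ 17 / 50 := fun m hm =>
    ⟨hr.p_lower m hm, hr.p_upper m hm⟩
  -- The recursion is decreasing in `a m`, so lower and upper bounds alternate and tighten towards
  -- `1/2`, starting from `a m ≤ 1`.
  have low1 : ∀ m, N + 1 ≤ m → 1 / 3 ≤ a m := by
    intro m hm
    obtain ⟨m, rfl⟩ : ∃ m', m = m' + 1 := ⟨m - 1, by omega⟩
    have := hrec m (by omega)
    have := hp (m + 1) (by omega)
    have := ha1 m (by omega)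
    have := ha0 (m + 1) (by omega)
    have : p (m + 1) + (1 - p (m + 1)) * a m ≤ 1 := by nlinarith
    nlinarith
  have up1 : ∀ m, N + 2 ≤ m → a m ≤ 61 / 100 := by
    intro m hm
    obtain ⟨m, rfl⟩ : ∃ m', m = m' + 1 := ⟨m - 1, by omega⟩
    have := hrec m (by omega)
    have := hp (m + 1) (by omega)
    have := low1 m (by omega)
    have : p (m + 1) + (1 - p (m + 1)) * (1 / 3) ≤ p (m + 1) + (1 - p (m + 1)) * a m := by nlinarith
    by_contra! hlt
    nlinarith
  have low2 : ∀ m, N + 3 ≤ m → 45 / 100 ≤ a m := by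
    intro m hm
    obtain ⟨m, rfl⟩ : ∃ m', m = m' + 1 := ⟨m - 1, by omega⟩
    have := hrec m (by omega)
    have := hp (m + 1) (by omega)
    have := up1 m (by omega)
    have := low1 (m + 1) (by omega)
    have : p (m + 1) + (1 - p (m + 1)) * a m ≤ p (m + 1) + (1 - p (m + 1)) * (61 / 100) := by
      nlinarith
    by_contra! hlt
    nlinarith
  have up2 : ∀ m, N + 4 ≤ m → a m ≤ 14 / 25 := by
    intro m hm
    obtain ⟨m, rfl⟩ : ∃ m', m = m' + 1 := ⟨m - 1, by omega⟩
    have := hrec m (by omega)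
    have := hp (m + 1) (by omega)
    have := low2 m (by omega)
    have : p (m + 1) + (1 - p (m + 1)) * (45 / 100) ≤ p (m + 1) + (1 - p (m + 1)) * a m := by
      nlinarith
    by_contra! hlt
    nlinarith
  have e2 := hepos (m + 1) (by omega)
  have l := low1 m (by omega)
  have u := up2 m hm
  simp only [a] at l u
  rw [le_div_iff₀ e2] at l
  rw [div_le_iff₀ e2] at u
  exact ⟨l, u⟩

/-- Site `k` is jumped over with conditional chance at most `14/25`, so from `x` it is hit first
with chance at least `11/25`; and `(11/25) * (1/3) ≥ 1/7`. -/
theorem RateBounds.skipProb_start_bounds (hr : RateBounds p t N) (h : IsWalkFamily p Q) {x k : ℕ}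
    (hk : N + 5 ≤ k) (hx : x < k) :
    11 / 25 * skipProb Q (k + 1) k ≤ skipProb Q (k + 1) x ∧
      escProb Q (k + 1) ≤ 7 * skipProb Q (k + 1) x := by
  obtain ⟨m, rfl⟩ : ∃ m, k = m + 1 := ⟨k - 1, by omega⟩
  have h1 := h.skipProb_succ_mul_escProb (k := m) (x := x) (by omega)
  have h2 := h.skipProb_succ_mul_escProb (k := m + 1) (x := x) (by omega)
  have e0 := hr.escProb_pos h (j := m) (by omega)
  have e1 := hr.escProb_pos h (j := m + 1) (by omega)
  have b0 := hr.skipProb_succ_bounds h (m := m) (by omega)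
  have b1 := hr.skipProb_succ_bounds h (m := m + 1) (by omega)
  have n0 := skipProb_nonneg (Q := Q) m x
  have n1 := skipProb_nonneg (Q := Q) (m + 1) m
  have n2 := skipProb_nonneg (Q := Q) (m + 1 + 1) (m + 1)
  have h3 : skipProb Q (m + 1) x ≤ skipProb Q (m + 1) m := by
    refine le_of_mul_le_mul_right ?_ e0
    nlinarith
  have h4 : 11 / 25 * skipProb Q (m + 1 + 1) (m + 1) ≤ skipProb Q (m + 1 + 1) x := by
    refine le_of_mul_le_mul_right ?_ e1
    nlinarith
  exact ⟨h4, by linarith⟩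

/-- Once at `k`, the walk returns to `j` with chance at most `exp (-20) ≤ 1/20`, so the skips
decouple with factor `(20/19) * (25/11) ≤ 12/5`. The `25/11` comes from replacing the starting point
`k` by `x`. -/
theorem RateBounds.skip_two_far_le (hr : RateBounds p t N) (h : IsWalkFamily p Q) {x j k : ℕ}
    (hj : N + 5 ≤ j) (hx : x < j) (hjk : j ≤ k) (hs : 40 ≤ ∑ i ∈ Finset.Ioc j k, t i) :
    (Q x).real (skipEvent j ∩ skipEvent (k + 1)) ≤
      12 / 5 * (skipProb Q j x * skipProb Q (k + 1) x) := by
  have h1 := h.real_mul_escProb (D := skipEvent j ∩ skipEvent (k + 1)) (j := j) (x := x)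
    (measurableSet_skipEvent_inter _ _) Set.inter_subset_left
    (fun y hy => preimage_consPath_skipEvent_inter hy.ne (by omega)) (by omega)
  have h2 := h.skip_two_mul_skipProb_le (j := j) (k := k) (n := j + 1) hjk (by omega) (by omega)
  have h3 := hr.one_sub_skipProb_le_exp h (j := j) (n := k) (by omega) hjk
  have h4 : Real.exp (-(1 / 2 * ∑ i ∈ Finset.Ioc j k, t i)) ≤ 1 / 20 := by
    refine (exp_neg_le_inv (by linarith)).trans ?_
    exact one_div_le_one_div_of_le (by norm_num) (by linarith)
  have h5 := (hr.skipProb_start_bounds h (x := x) (k := k) (by omega) (by omega)).1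
  have e := hr.escProb_pos h (j := j) (by omega)
  have nU : 0 ≤ (Q (j + 1)).real (skipEvent j ∩ skipEvent (k + 1)) := measureReal_nonneg
  have n1 := skipProb_nonneg (Q := Q) j x
  have n2 := skipProb_nonneg (Q := Q) (k + 1) x
  change _ ≤ skipProb Q (k + 1) k * escProb Q j at h2
  have h6 : (Q (j + 1)).real (skipEvent j ∩ skipEvent (k + 1)) ≤
      12 / 5 * (skipProb Q (k + 1) x * escProb Q j) := by
    have : 19 / 20 * (Q (j + 1)).real (skipEvent j ∩ skipEvent (k + 1)) ≤
        25 / 11 * skipProb Q (k + 1) x * escProb Q j := by nlinarith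
    have : 0 ≤ skipProb Q (k + 1) x * escProb Q j := by positivity
    nlinarith
  refine le_of_mul_le_mul_right ?_ e
  rw [h1]
  nlinarith [mul_le_mul_of_nonneg_left h6 n1]

end Ratio

/-! ### Weights and moments of the number of skipped sites. -/

theorem one_div_add_one_le_log {y : ℝ} (hy : 0 < y) :
    1 / (y + 1) ≤ Real.log (y + 1) - Real.log y := by
  have h1 : Real.log (y / (y + 1)) ≤ y / (y + 1) - 1 := Real.log_le_sub_one_of_pos (by positivity)
  rw [Real.log_div (by positivity) (by positivity)] at h1
  have h2 : y / (y + 1) - 1 = -(1 / (y + 1)) := by field_simp; ring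
  linarith

theorem log_sub_log_le {a b : ℝ} (ha : 0 < a) (hb : 0 < b) :
    Real.log b - Real.log a ≤ (b - a) / a := by
  rw [← Real.log_div hb.ne' ha.ne', sub_div, div_self ha.ne']
  exact Real.log_le_sub_one_of_pos (by positivity)

theorem sum_Ioc_one_div_sub_le {j n : ℕ} (hjn : j + 1 ≤ n) :
    ∑ k ∈ Finset.Ioc j n, 1 / ((k : ℝ) - j) ≤ 1 + Real.log (n - j) := by
  induction n, hjn using Nat.le_induction with
  | base => simp
  | succ n hn ih =>
    have hn' : (j : ℝ) + 1 ≤ n := by exact_mod_cast hn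
    rw [← Finset.insert_Ioc_right_eq_Ioc_add_one (by omega), Finset.sum_insert (by simp)]
    have := one_div_add_one_le_log (show (0 : ℝ) < n - j by linarith)
    have e : ((n + 1 : ℕ) : ℝ) - j = (n : ℝ) - j + 1 := by push_cast; ring
    rw [e]
    linarith

/-- The weight of a skipped site in the second moment argument. -/
noncomputable def skipWeight (β : ℝ) (k : ℕ) : ℝ :=
  1 / (slowFactor β k * Real.log k * Real.log (Real.log k))

theorem skipWeight_mul_logRate {β : ℝ} {k : ℕ} (hk : 0 < slowFactor β k) :
    skipWeight β k * logRate β k = 1 / (k * Real.log k * Real.log (Real.log k)) := by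
  unfold skipWeight logRate
  rw [div_mul_div_comm, one_mul, show slowFactor β k * Real.log k * Real.log (Real.log k) * k =
    slowFactor β k * (k * Real.log k * Real.log (Real.log k)) by ring, ← div_div, div_self hk.ne']

theorem one_le_slowFactor_mul {β : ℝ} (hβ : β ≤ 1) {k : ℕ}
    (hk : 1 ≤ Real.log (Real.log k)) : 1 ≤ slowFactor β k * Real.log (Real.log k) := by
  unfold slowFactor
  nth_rewrite 2 [← Real.rpow_one (Real.log (Real.log k))]
  rw [← Real.rpow_add (by linarith)]
  exact Real.one_le_rpow hk (by linarith)

theorem skipWeight_le_one {β : ℝ} (hβ : β ≤ 1) {k : ℕ} (h1 : 1 ≤ Real.log k)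
    (hk : 1 ≤ Real.log (Real.log k)) : skipWeight β k ≤ 1 := by
  have := one_le_slowFactor_mul hβ hk
  unfold skipWeight
  rw [div_le_one (by nlinarith)]
  nlinarith

section Infinite

variable {β : ℝ} {Q : ℕ → Measure (ℕ → ℕ)}

/-- After `j` is skipped, reaching `k` without returning to `j` costs about `t j / s + t j`, with
`s` the rate sum over `(j, k]`. -/
theorem exists_skip_two_near_le (h : IsWalkFamily (upProb (perturbation β)) Q) :
    ∃ C : ℝ, 1 ≤ C ∧ ∀ᶠ j : ℕ in atTop, ∀ k, j < k →
      (Q (j + 1)).real (skipEvent j ∩ skipEvent k) ≤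
        C * escProb Q k * (1 / ((k : ℝ) - j) + 1 / j + logRate β j) := by
  obtain ⟨C, hC, hcomp⟩ := exists_logRate_comparable β
  obtain ⟨N, hN⟩ := exists_rateBounds β
  have hC2 : C ≤ C ^ 2 := by nlinarith
  refine ⟨2 * C ^ 2, by nlinarith, ?_⟩
  filter_upwards [hcomp, eventually_ge_atTop N, eventually_ge_atTop 4] with j hj hjN h4 k hjk
  have hj0 : (0 : ℝ) < j := by positivity
  have hkj : (0 : ℝ) < (k : ℝ) - j := by
    have : (j : ℝ) < k := by exact_mod_cast hjk
    linarith
  have ht := hN.pos j hjN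
  have he := hN.escProb_pos h (j := k) (by omega)
  have h1 := hN.skip_two_mul_sum_le h hjN hjk
  have h2 := hj.1 (j + 1) (by omega) (by nlinarith)
  set U := (Q (j + 1)).real (skipEvent j ∩ skipEvent k)
  have hU : 0 ≤ U := measureReal_nonneg
  set s := ∑ i ∈ Finset.Ioc j k, logRate β i
  -- `d` is `min (k - j) j`: rates are compared with `logRate β j` only up to `2 j`.
  obtain ⟨d, hd0, hds, hdinv⟩ : ∃ d : ℝ, 0 < d ∧ d * logRate β j ≤ C * s ∧
      1 / d ≤ 1 / ((k : ℝ) - j) + 1 / j := by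
    have hsum : ∀ l, j ≤ l → l ≤ k → l ≤ 2 * j → ((l : ℝ) - j) * logRate β j ≤ C * s := by
      intro l hl hlk hl2
      calc ((l : ℝ) - j) * logRate β j = ∑ i ∈ Finset.Ioc j l, logRate β j := by
            rw [Finset.sum_const, nsmul_eq_mul, Nat.card_Ioc, Nat.cast_sub hl]
        _ ≤ ∑ i ∈ Finset.Ioc j l, C * logRate β i := by
            refine Finset.sum_le_sum fun i hi => ?_
            have := Finset.mem_Ioc.1 hi
            exact hj.2 i (by omega) (by omega)
        _ ≤ ∑ i ∈ Finset.Ioc j k, C * logRate β i := by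
            refine Finset.sum_le_sum_of_subset_of_nonneg
              (Finset.Ioc_subset_Ioc_right hlk) fun i hi _ => ?_
            have := hN.pos i (by have := (Finset.mem_Ioc.1 hi).1; omega)
            positivity
        _ = C * s := by rw [← Finset.mul_sum]
    rcases le_or_gt k (2 * j) with hk | hk
    · refine ⟨(k : ℝ) - j, hkj, hsum k hjk.le le_rfl hk, ?_⟩
      have : (0 : ℝ) < 1 / j := by positivity
      linarith
    · refine ⟨j, hj0, ?_, ?_⟩
      · have := hsum (2 * j) (by omega) hk.le le_rfl
        push_cast at this
        linarith
      · have : 0 < 1 / ((k : ℝ) - j) := by positivity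
        linarith
  have hs : 0 < s := by
    have : 0 < d * logRate β j := by positivity
    nlinarith
  have h3 : U * s ≤ escProb Q k * (C * logRate β j * (1 + 2 * s)) := by
    refine h1.trans ?_
    gcongr
  have h4 : C * logRate β j * (1 + 2 * s) ≤ s * (2 * C ^ 2 * (1 / d + logRate β j)) := by
    have h5 : logRate β j ≤ C * s * (1 / d) := by
      rw [mul_one_div, le_div_iff₀ hd0]
      linarith
    have h6 : C * logRate β j ≤ C ^ 2 * s * (1 / d) := by nlinarith
    have h7 : C * (logRate β j * s) ≤ C ^ 2 * (logRate β j * s) := by gcongr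
    have h8 : 0 ≤ C ^ 2 * s * (1 / d) := by positivity
    nlinarith
  have h5 : U ≤ escProb Q k * (2 * C ^ 2 * (1 / d + logRate β j)) := by
    refine le_of_mul_le_mul_right ?_ hs
    calc U * s ≤ escProb Q k * (C * logRate β j * (1 + 2 * s)) := h3
      _ ≤ escProb Q k * (s * (2 * C ^ 2 * (1 / d + logRate β j))) := by gcongr
      _ = _ := by ring
  calc U ≤ escProb Q k * (2 * C ^ 2 * (1 / d + logRate β j)) := h5
    _ ≤ escProb Q k * (2 * C ^ 2 * (1 / ((k : ℝ) - j) + 1 / j + logRate β j)) := by gcongr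
    _ = _ := by ring

/-- The expected weight of skips in `(j, j²]`, given that `j` is skipped, stays bounded. Both `∑
1/(k - j)` and `∑ 1/k` are of order `log j`, which the weights cancel. -/
theorem exists_sum_skipWeight_near_le (h : IsWalkFamily (upProb (perturbation β)) Q)
    (hβ : β ≤ 1) : ∃ C : ℝ, 1 ≤ C ∧ ∀ᶠ j : ℕ in atTop,
      ∑ k ∈ Finset.Ioc j (j ^ 2),
        skipWeight β k * (Q (j + 1)).real (skipEvent j ∩ skipEvent k) ≤ C * escProb Q j := by
  obtain ⟨C₁, hC₁, hnear⟩ := exists_skip_two_near_le h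
  obtain ⟨C₂, hC₂, hesc⟩ := exists_escProb_comparable h
  have hC12 : 1 ≤ C₁ * C₂ := one_le_mul_of_one_le_of_one_le hC₁ hC₂
  refine ⟨C₁ * C₂ * 5 * C₂, by nlinarith, ?_⟩
  obtain ⟨N₂, hN₂⟩ := eventually_atTop.1 hesc
  obtain ⟨N₃, hN₃⟩ := eventually_atTop.1 (eventually_slowFactor_pos β)
  filter_upwards [hnear, eventually_ge_atTop N₂, eventually_ge_atTop N₃, eventually_ge_atTop 2,
    tendsto_log_nat.eventually_ge_atTop 1, tendsto_loglog_nat.eventually_ge_atTop 1,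
    eventually_logRate_pos β] with j hnear hj2 hj3 h2 hlog hll ht
  have hj0 : (0 : ℝ) < j := by positivity
  set l := Real.log j with hl
  set m := Real.log l with hm
  have hterm : ∀ k ∈ Finset.Ioc j (j ^ 2),
      skipWeight β k * (Q (j + 1)).real (skipEvent j ∩ skipEvent k) ≤
        C₁ * C₂ * (1 / (j * l * m) * (1 / ((k : ℝ) - j)) +
          (1 / j + logRate β j) / (l * m) * (1 / k)) := by
    intro k hk
    have hk' := Finset.mem_Ioc.1 hk
    have hjk : (j : ℝ) < k := by exact_mod_cast hk'.1
    have hkj : 0 < (k : ℝ) - j := by linarith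
    have hk0 : (0 : ℝ) < k := by linarith
    have hlk : l ≤ Real.log k := Real.log_le_log hj0 hjk.le
    have hmk : m ≤ Real.log (Real.log k) := Real.log_le_log (by linarith) hlk
    have hS := hN₃ k (by omega)
    have hw : 0 < skipWeight β k := by
      unfold skipWeight
      have : 0 < Real.log k := by linarith
      have : 0 < Real.log (Real.log k) := by linarith
      positivity
    have hg : skipWeight β k * logRate β k ≤ 1 / (k * l * m) := by
      rw [skipWeight_mul_logRate hS]
      gcongr
    have hg' : 1 / (k * l * m) ≤ 1 / (j * l * m) := by gcongr
    calc skipWeight β k * (Q (j + 1)).real (skipEvent j ∩ skipEvent k)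
        ≤ skipWeight β k *
          (C₁ * escProb Q k * (1 / ((k : ℝ) - j) + 1 / j + logRate β j)) := by
          gcongr
          exact hnear k hk'.1
      _ ≤ skipWeight β k *
          (C₁ * (C₂ * logRate β k) * (1 / ((k : ℝ) - j) + 1 / j + logRate β j)) := by
          gcongr
          exact (hN₂ k (by omega)).1
      _ = C₁ * C₂ * ((skipWeight β k * logRate β k) * (1 / ((k : ℝ) - j)) +
          (1 / j + logRate β j) * (skipWeight β k * logRate β k)) := by ring
      _ ≤ C₁ * C₂ * (1 / (j * l * m) * (1 / ((k : ℝ) - j)) +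
          (1 / j + logRate β j) * (1 / (k * l * m))) := by
          gcongr
          exact hg.trans hg'
      _ = _ := by
          congr 2
          field_simp
  have hsum1 : ∑ k ∈ Finset.Ioc j (j ^ 2), 1 / ((k : ℝ) - j) ≤ 3 * l := by
    have h1 := sum_Ioc_one_div_sub_le (show j + 1 ≤ j ^ 2 by nlinarith)
    have h3 : (2 : ℝ) ≤ j := by exact_mod_cast h2
    have h2 : Real.log (((j ^ 2 : ℕ) : ℝ) - j) ≤ Real.log ((j : ℝ) ^ 2) := by
      refine Real.log_le_log ?_ ?_
      · push_cast; nlinarith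
      · push_cast; linarith
    rw [Real.log_pow] at h2
    push_cast at h1 h2 ⊢
    linarith
  have hsum2 : ∑ k ∈ Finset.Ioc j (j ^ 2), 1 / (k : ℝ) ≤ l := by
    have h1 := sum_Ioc_le_log (a := j) (b := j ^ 2) (by omega) (by nlinarith)
    push_cast at h1
    rw [Real.log_pow] at h1
    push_cast at h1
    linarith
  -- Here `β ≤ 1` enters: `(log log j)^(-β)` is at least `1 / log log j`.
  have hjm : 1 / (j * m) ≤ logRate β j := by
    have := one_le_slowFactor_mul hβ hll
    rw [logRate, div_le_div_iff₀ (by positivity) hj0]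
    nlinarith
  have htm : logRate β j / m ≤ logRate β j := div_le_self ht.le hll
  calc ∑ k ∈ Finset.Ioc j (j ^ 2),
        skipWeight β k * (Q (j + 1)).real (skipEvent j ∩ skipEvent k)
      ≤ ∑ k ∈ Finset.Ioc j (j ^ 2), C₁ * C₂ * (1 / (j * l * m) * (1 / ((k : ℝ) - j)) +
          (1 / j + logRate β j) / (l * m) * (1 / k)) := Finset.sum_le_sum hterm
    _ = C₁ * C₂ * (1 / (j * l * m) * ∑ k ∈ Finset.Ioc j (j ^ 2), 1 / ((k : ℝ) - j) +
          (1 / j + logRate β j) / (l * m) * ∑ k ∈ Finset.Ioc j (j ^ 2), 1 / (k : ℝ)) := by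
        rw [← Finset.mul_sum, Finset.sum_add_distrib, Finset.mul_sum, Finset.mul_sum]
    _ ≤ C₁ * C₂ * (1 / (j * l * m) * (3 * l) + (1 / j + logRate β j) / (l * m) * l) := by
        gcongr
    _ = C₁ * C₂ * (4 * (1 / (j * m)) + logRate β j / m) := by
        field_simp
        ring
    _ ≤ C₁ * C₂ * (4 * logRate β j + logRate β j) := by gcongr
    _ = C₁ * C₂ * 5 * logRate β j := by ring
    _ ≤ C₁ * C₂ * 5 * (C₂ * escProb Q j) := by
        gcongr
        exact (hN₂ j hj2).2
    _ = _ := by ring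

/-- Each term dominates the increment of `log log log`, so the sum telescopes from below. -/
theorem tendsto_sum_inv_log_log {N : ℕ} (hN : 1 ≤ Real.log (Real.log N)) (hN1 : 1 ≤ Real.log N)
    (hN0 : 0 < N) :
    Tendsto (fun n : ℕ => ∑ k ∈ Finset.Ioc N n, 1 / (k * Real.log k * Real.log (Real.log k)))
      atTop atTop := by
  have hN0' : (0 : ℝ) < N := by exact_mod_cast hN0
  have hlog : ∀ n : ℕ, N ≤ n → 1 ≤ Real.log n := fun n hn =>
    hN1.trans (Real.log_le_log hN0' (by exact_mod_cast hn))
  have hll : ∀ n : ℕ, N ≤ n → 1 ≤ Real.log (Real.log n) := fun n hn =>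
    hN.trans (Real.log_le_log (by linarith) (Real.log_le_log hN0' (by exact_mod_cast hn)))
  let T : ℕ → ℝ := fun n => Real.log (Real.log (Real.log n))
  have hstep : ∀ n : ℕ, N ≤ n →
      T (n + 1) - T n ≤ 1 / (n * Real.log n * Real.log (Real.log n)) := by
    intro n hn
    have hn0 : (0 : ℝ) < n := by exact_mod_cast (by omega : 0 < n)
    have a1 := hlog n hn
    have a2 := hll n hn
    have a3 := hlog (n + 1) (by omega)
    have a4 := hll (n + 1) (by omega)
    have b1 := log_sub_log_le (a := (n : ℝ)) (b := ((n + 1 : ℕ) : ℝ)) hn0 (by positivity)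
    have b2 := log_sub_log_le (show 0 < Real.log n by linarith)
      (show 0 < Real.log ((n + 1 : ℕ) : ℝ) by linarith)
    have b3 := log_sub_log_le (show 0 < Real.log (Real.log n) by linarith)
      (show 0 < Real.log (Real.log ((n + 1 : ℕ) : ℝ)) by linarith)
    have e : (((n + 1 : ℕ) : ℝ) - n) / n = 1 / n := by push_cast; ring
    rw [e] at b1
    calc T (n + 1) - T n ≤ _ := b3
      _ ≤ ((1 / n) / Real.log n) / Real.log (Real.log n) := by
          gcongr
          refine b2.trans ?_
          gcongr
      _ = _ := by rw [div_div, div_div, mul_assoc]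
  have hle : ∀ n : ℕ, N ≤ n → T (n + 1) - T (N + 1) ≤
      ∑ k ∈ Finset.Ioc N n, 1 / (k * Real.log k * Real.log (Real.log k)) := by
    intro n hn
    induction n, hn using Nat.le_induction with
    | base => simp
    | succ n hn ih =>
      rw [← Finset.insert_Ioc_right_eq_Ioc_add_one hn, Finset.sum_insert (by simp)]
      have := hstep (n + 1) (by omega)
      linarith
  have hT : Tendsto (fun n : ℕ => T (n + 1) - T (N + 1)) atTop atTop :=
    tendsto_atTop_add_const_right _ _
      ((Real.tendsto_log_atTop.comp tendsto_loglog_nat).comp (tendsto_add_atTop_nat 1))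
  refine tendsto_atTop_mono' _ ?_ hT
  filter_upwards [eventually_ge_atTop N] with n hn using hle n hn

/-- A second moment lower bound for the upper tail. -/
theorem sub_sq_le_integral_sq_mul {Ω : Type*} [MeasurableSpace Ω] {μ : Measure Ω}
    [IsProbabilityMeasure μ] {Z : Ω → ℝ} (hZ : Measurable Z) (h2 : Integrable (fun ω => Z ω ^ 2) μ)
    (h1 : Integrable Z μ) {R : ℝ} (hR : 0 ≤ R) (hRZ : R ≤ ∫ ω, Z ω ∂μ) :
    (∫ ω, Z ω ∂μ - R) ^ 2 ≤ (∫ ω, Z ω ^ 2 ∂μ) * μ.real {ω | R < Z ω} := by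
  set E := {ω | R < Z ω}
  have hE : MeasurableSet E := measurableSet_lt measurable_const hZ
  have hZE : Integrable (E.indicator Z) μ := h1.indicator hE
  have hA : ∫ ω, Z ω ∂μ - R ≤ ∫ ω, E.indicator Z ω ∂μ := by
    have hle : ∫ ω, Z ω ∂μ ≤ ∫ ω, (R + E.indicator Z ω) ∂μ := by
      refine integral_mono h1 ((integrable_const R).add hZE) fun ω => ?_
      by_cases hω : ω ∈ E
      · simp only [Set.indicator_of_mem hω]; linarith
      · simp only [Set.indicator_of_notMem hω]
        have : ¬ R < Z ω := hω
        linarith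
    rw [integral_add (integrable_const R) hZE] at hle
    simp only [integral_const, probReal_univ, smul_eq_mul, one_mul] at hle
    linarith
  -- The quadratic in `c` is the mean of `(Z - c * 1_E)²`; its discriminant gives Cauchy–Schwarz.
  have hquad : ∀ c : ℝ, 0 ≤ μ.real E * (c * c) + (-2 * ∫ ω, E.indicator Z ω ∂μ) * c +
      ∫ ω, Z ω ^ 2 ∂μ := by
    intro c
    have hI : Integrable (E.indicator fun _ => (1 : ℝ)) μ := (integrable_const 1).indicator hE
    have hnn : 0 ≤ ∫ ω, (Z ω ^ 2 - 2 * c * E.indicator Z ω +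
        c ^ 2 * E.indicator (fun _ => (1 : ℝ)) ω) ∂μ := by
      refine integral_nonneg fun ω => ?_
      by_cases hω : ω ∈ E
      · simp only [Set.indicator_of_mem hω, Pi.zero_apply]; nlinarith [sq_nonneg (Z ω - c)]
      · simp only [Set.indicator_of_notMem hω, Pi.zero_apply]; nlinarith [sq_nonneg (Z ω)]
    have hsub : Integrable (fun ω => Z ω ^ 2 - 2 * c * E.indicator Z ω) μ :=
      h2.sub (hZE.const_mul _)
    rw [integral_add hsub (hI.const_mul _),
      integral_sub h2 (hZE.const_mul _), integral_const_mul, integral_const_mul,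
      integral_indicator_const _ hE] at hnn
    simp only [smul_eq_mul, mul_one] at hnn
    linarith
  have := discrim_le_zero hquad
  unfold discrim at this
  nlinarith [sq_nonneg (∫ ω, E.indicator Z ω ∂μ)]

/-- The weighted number of skipped sites in `(N, n]`. -/
noncomputable def skipCount (β : ℝ) (N n : ℕ) (ω : ℕ → ℕ) : ℝ :=
  ∑ k ∈ Finset.Ioc N n, skipWeight β k * (skipEvent k).indicator (fun _ => (1 : ℝ)) ω

theorem measurable_skipCount (β : ℝ) (N n : ℕ) : Measurable (skipCount β N n) :=
  Finset.measurable_sum _ fun k _ =>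
    (measurable_const.indicator (measurableSet_skipEvent k)).const_mul _

theorem skipCount_sq (β : ℝ) (N n : ℕ) (ω : ℕ → ℕ) :
    skipCount β N n ω ^ 2 = ∑ j ∈ Finset.Ioc N n, ∑ k ∈ Finset.Ioc N n,
      skipWeight β j * skipWeight β k *
        (skipEvent j ∩ skipEvent k).indicator (fun _ => (1 : ℝ)) ω := by
  rw [sq, skipCount, Finset.sum_mul_sum]
  refine Finset.sum_congr rfl fun j _ => Finset.sum_congr rfl fun k _ => ?_
  rw [mul_mul_mul_comm, ← Set.inter_indicator_mul]
  simp

theorem integrable_indicator_one (h : IsWalkFamily (upProb (perturbation β)) Q) (x : ℕ)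
    {D : Set (ℕ → ℕ)} (hD : MeasurableSet D) :
    Integrable (D.indicator fun _ => (1 : ℝ)) (Q x) := by
  have := h.isProbabilityMeasure x
  exact (integrable_const 1).indicator hD

theorem integral_skipCount (h : IsWalkFamily (upProb (perturbation β)) Q) (x N n : ℕ) :
    Integrable (skipCount β N n) (Q x) ∧
      ∫ ω, skipCount β N n ω ∂(Q x) = ∑ k ∈ Finset.Ioc N n, skipWeight β k * skipProb Q k x := by
  have hi : ∀ k ∈ Finset.Ioc N n, Integrable
      (fun ω => skipWeight β k * (skipEvent k).indicator (fun _ => (1 : ℝ)) ω) (Q x) := fun k _ =>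
    (integrable_indicator_one h x (measurableSet_skipEvent k)).const_mul _
  refine ⟨integrable_finsetSum _ hi, ?_⟩
  unfold skipCount
  rw [integral_finsetSum _ hi]
  refine Finset.sum_congr rfl fun k _ => ?_
  rw [integral_const_mul, integral_indicator_const _ (measurableSet_skipEvent k), smul_eq_mul,
    mul_one, skipProb]

theorem integral_skipCount_sq (h : IsWalkFamily (upProb (perturbation β)) Q) (x N n : ℕ) :
    Integrable (fun ω => skipCount β N n ω ^ 2) (Q x) ∧
      ∫ ω, skipCount β N n ω ^ 2 ∂(Q x) = ∑ j ∈ Finset.Ioc N n, ∑ k ∈ Finset.Ioc N n,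
        skipWeight β j * skipWeight β k * (Q x).real (skipEvent j ∩ skipEvent k) := by
  have hi : ∀ j ∈ Finset.Ioc N n, ∀ k ∈ Finset.Ioc N n, Integrable
      (fun ω => skipWeight β j * skipWeight β k *
        (skipEvent j ∩ skipEvent k).indicator (fun _ => (1 : ℝ)) ω) (Q x) := fun j _ k _ =>
    (integrable_indicator_one h x (measurableSet_skipEvent_inter j k)).const_mul _
  simp only [skipCount_sq]
  refine ⟨integrable_finsetSum _ fun j hj => integrable_finsetSum _ (hi j hj), ?_⟩
  rw [integral_finsetSum _ fun j hj => integrable_finsetSum _ (hi j hj)]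
  refine Finset.sum_congr rfl fun j hj => ?_
  rw [integral_finsetSum _ (hi j hj)]
  refine Finset.sum_congr rfl fun k _ => ?_
  rw [integral_const_mul, integral_indicator_const _ (measurableSet_skipEvent_inter j k),
    smul_eq_mul, mul_one]

end Infinite

section Infinite

variable {β : ℝ} {Q : ℕ → Measure (ℕ → ℕ)}

/-- Split the pairs into diagonal, near (`k ≤ j²`) and far. The first two are linear in the mean;
only far pairs produce the quadratic term, whose coefficient fixes the final probability. -/
theorem exists_second_moment_le (h : IsWalkFamily (upProb (perturbation β)) Q) (hβ : β ≤ 1)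
    (x : ℕ) : ∃ (A : ℝ) (N : ℕ), 0 ≤ A ∧
      (∀ k, N < k → 0 ≤ skipWeight β k ∧ skipWeight β k ≤ 1) ∧
      Tendsto (fun n => ∑ k ∈ Finset.Ioc N n, skipWeight β k * skipProb Q k x) atTop atTop ∧
      ∀ n, ∑ j ∈ Finset.Ioc N n, ∑ k ∈ Finset.Ioc N n,
        skipWeight β j * skipWeight β k * (Q x).real (skipEvent j ∩ skipEvent k) ≤
        A * (∑ k ∈ Finset.Ioc N n, skipWeight β k * skipProb Q k x) +
          12 / 5 * (∑ k ∈ Finset.Ioc N n, skipWeight β k * skipProb Q k x) ^ 2 := by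
  obtain ⟨N₀, hN₀⟩ := exists_rateBounds β
  obtain ⟨C₁, hC₁, hnear⟩ := exists_sum_skipWeight_near_le h hβ
  obtain ⟨C₂, hC₂, hesc⟩ := exists_escProb_comparable h
  obtain ⟨N, hN⟩ := eventually_atTop.1 (hnear.and (hesc.and ((eventually_slowFactor_pos β).and
    ((tendsto_log_nat.eventually_ge_atTop 1).and ((tendsto_loglog_nat.eventually_ge_atTop 1).and
      (((tendsto_sum_logRate β).eventually_ge_atTop 40).and ((eventually_gt_atTop 0).and
        ((eventually_gt_atTop x).and (eventually_ge_atTop (N₀ + 6))))))))))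
  have hw0 : ∀ k, N ≤ k → 0 ≤ skipWeight β k := fun k hk => by
    obtain ⟨-, -, h1, h2, h3, -⟩ := hN k hk
    unfold skipWeight
    positivity
  have hw1 : ∀ k, N ≤ k → skipWeight β k ≤ 1 := fun k hk => by
    obtain ⟨-, -, h1, h2, h3, -⟩ := hN k hk
    exact skipWeight_le_one hβ h2 h3
  -- `1` is for the diagonal, where `w² ≤ w`; `2 * C₁` is for near pairs in either order.
  refine ⟨1 + 2 * C₁, N, by linarith, fun k hk => ⟨hw0 k hk.le, hw1 k hk.le⟩, ?_, fun n => ?_⟩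
  · obtain ⟨-, -, -, h2, h3, -, h4, -⟩ := hN N le_rfl
    have ht := (tendsto_sum_inv_log_log h3 h2 h4).const_mul_atTop
      (show 0 < 1 / (7 * C₂) by positivity)
    refine tendsto_atTop_mono (fun n => ?_) ht
    rw [Finset.mul_sum]
    refine Finset.sum_le_sum fun k hk => ?_
    have hk' := (Finset.mem_Ioc.1 hk).1
    obtain ⟨-, he, hS, -, -, -, -, hx, hk0⟩ := hN k hk'.le
    obtain ⟨-, -, -, -, -, -, -, hxN, hN0⟩ := hN N le_rfl
    obtain ⟨m, rfl⟩ : ∃ m, k = m + 1 := ⟨k - 1, by omega⟩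
    have h5 := (hN₀.skipProb_start_bounds h (x := x) (k := m) (by omega) (by omega)).2
    rw [← skipWeight_mul_logRate hS, one_div, inv_mul_le_iff₀ (by positivity)]
    have h6 : logRate β (m + 1) ≤ 7 * C₂ * skipProb Q (m + 1) x := by nlinarith [he.2]
    calc skipWeight β (m + 1) * logRate β (m + 1)
        ≤ skipWeight β (m + 1) * (7 * C₂ * skipProb Q (m + 1) x) :=
          mul_le_mul_of_nonneg_left h6 (hw0 _ hk'.le)
      _ = _ := by ring
  · set I := Finset.Ioc N n
    set w := skipWeight β
    set μ : ℕ → ℝ := fun k => skipProb Q k x with hμ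
    set F : ℕ → ℕ → ℝ := fun j k => w j * w k * (Q x).real (skipEvent j ∩ skipEvent k) with hF
    have hμ0 : ∀ k, 0 ≤ μ k := fun k => skipProb_nonneg _ _
    have hI : ∀ k ∈ I, N < k := fun k hk => (Finset.mem_Ioc.1 hk).1
    have hF0 : ∀ j k, N ≤ j → N ≤ k → 0 ≤ F j k := fun j k hj hk =>
      mul_nonneg (mul_nonneg (hw0 j hj) (hw0 k hk)) measureReal_nonneg
    have hFsymm : ∀ j k, F j k = F k j := fun j k => by
      simp only [hF, Set.inter_comm (skipEvent j)]; ring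
    set G : ℕ → ℕ → ℝ := fun j k => if k ∈ Finset.Ioc j (j ^ 2) then F j k else 0 with hG
    have hG0 : ∀ j k, N ≤ j → N ≤ k → 0 ≤ G j k := fun j k hj hk => by
      simp only [hG]
      split_ifs
      · exact hF0 j k hj hk
      · exact le_rfl
    have hfar : ∀ j k, N < j → j ^ 2 < k → F j k ≤ 12 / 5 * ((w j * μ j) * (w k * μ k)) := by
      intro j k hj hk
      obtain ⟨-, -, -, -, -, hs, -, hx, hj0⟩ := hN j hj.le
      have hjj : j ≤ j ^ 2 := Nat.le_self_pow (by norm_num) j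
      obtain ⟨m, rfl⟩ : ∃ m, k = m + 1 := ⟨k - 1, by omega⟩
      have hs' : 40 ≤ ∑ i ∈ Finset.Ioc j m, logRate β i := by
        refine hs.trans (Finset.sum_le_sum_of_subset_of_nonneg
          (Finset.Ioc_subset_Ioc_right (by omega)) fun i hi _ => ?_)
        exact (hN₀.pos i (by have := (Finset.mem_Ioc.1 hi).1; omega)).le
      have := hN₀.skip_two_far_le h (x := x) (j := j) (k := m) (by omega) hx (by omega) hs'
      calc F j (m + 1) ≤ w j * w (m + 1) * (12 / 5 * (μ j * μ (m + 1))) :=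
            mul_le_mul_of_nonneg_left this
              (mul_nonneg (hw0 j hj.le) (hw0 (m + 1) (by omega)))
        _ = _ := by ring
    have hpt : ∀ j ∈ I, ∀ k ∈ I, F j k ≤ (if j = k then w j * μ j else 0) + G j k + G k j +
        12 / 5 * ((w j * μ j) * (w k * μ k)) := by
      intro j hj k hk
      have hj' := hI j hj
      have hk' := hI k hk
      have g1 := hG0 j k hj'.le hk'.le
      have g2 := hG0 k j hk'.le hj'.le
      have hprod : 0 ≤ 12 / 5 * ((w j * μ j) * (w k * μ k)) := by
        have := mul_nonneg (mul_nonneg (hw0 j hj'.le) (hμ0 j)) (mul_nonneg (hw0 k hk'.le) (hμ0 k))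
        linarith
      rcases lt_trichotomy j k with hlt | rfl | hlt
      · rw [if_neg hlt.ne]
        rcases le_or_gt k (j ^ 2) with hle | hgt
        · have : G j k = F j k := if_pos (Finset.mem_Ioc.2 ⟨hlt, hle⟩)
          linarith
        · linarith [hfar j k hj' hgt]
      · rw [if_pos rfl]
        have : F j j ≤ w j * μ j := by
          simp only [hF, Set.inter_self]
          have h1 := mul_nonneg (hw0 j hj'.le) (hμ0 j)
          have h2 := hw1 j hj'.le
          change w j * w j * μ j ≤ _
          nlinarith
        linarith
      · rw [if_neg hlt.ne']
        rcases le_or_gt j (k ^ 2) with hle | hgt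
        · have : G k j = F k j := if_pos (Finset.mem_Ioc.2 ⟨hlt, hle⟩)
          linarith [hFsymm j k]
        · linarith [hfar k j hk' hgt, hFsymm j k]
    -- Multiplying by `escProb Q j` factors the joint probability at the passage over `j`, which
    -- moves the start to `j + 1`.
    have hrow : ∀ j ∈ I, ∑ k ∈ I, G j k ≤ C₁ * (w j * μ j) := by
      intro j hj
      have hj' := hI j hj
      obtain ⟨hnr, -, -, -, -, -, -, hx, hj0⟩ := hN j hj'.le
      have he := hN₀.escProb_pos h (j := j) (by omega)
      have hx1 : ∀ k ∈ Finset.Ioc j (j ^ 2), F j k * escProb Q j =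
          (w j * μ j) * (w k * (Q (j + 1)).real (skipEvent j ∩ skipEvent k)) := by
        intro k hk
        have hk' := Finset.mem_Ioc.1 hk
        have h1 := h.real_mul_escProb (D := skipEvent j ∩ skipEvent k) (j := j) (x := x)
          (measurableSet_skipEvent_inter _ _) Set.inter_subset_left
          (fun y hy => preimage_consPath_skipEvent_inter hy.ne (by omega)) (by omega)
        simp only [hF]
        rw [mul_assoc, h1]
        ring
      have h2 : ∑ k ∈ I, G j k ≤ ∑ k ∈ Finset.Ioc j (j ^ 2), F j k := by
        rw [← Finset.sum_filter]
        refine Finset.sum_le_sum_of_subset_of_nonneg (fun k hk => (Finset.mem_filter.1 hk).2)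
          fun k hk _ => hF0 j k hj'.le ?_
        have := (Finset.mem_Ioc.1 hk).1
        omega
      refine h2.trans (le_of_mul_le_mul_right ?_ he)
      rw [Finset.sum_mul, Finset.sum_congr rfl hx1, ← Finset.mul_sum]
      calc w j * μ j * ∑ k ∈ Finset.Ioc j (j ^ 2), w k * (Q (j + 1)).real (skipEvent j ∩ skipEvent k)
          ≤ w j * μ j * (C₁ * escProb Q j) :=
            mul_le_mul_of_nonneg_left hnr (mul_nonneg (hw0 j hj'.le) (hμ0 j))
        _ = _ := by ring
    set M := ∑ k ∈ I, w k * μ k with hM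
    have hGsum : ∑ j ∈ I, ∑ k ∈ I, G j k ≤ C₁ * M := by
      rw [hM, Finset.mul_sum]
      exact Finset.sum_le_sum hrow
    calc ∑ j ∈ I, ∑ k ∈ I, F j k
        ≤ ∑ j ∈ I, ∑ k ∈ I, ((if j = k then w j * μ j else 0) + G j k + G k j +
          12 / 5 * ((w j * μ j) * (w k * μ k))) :=
          Finset.sum_le_sum fun j hj => Finset.sum_le_sum fun k hk => hpt j hj k hk
      _ = M + ∑ j ∈ I, ∑ k ∈ I, G j k + ∑ j ∈ I, ∑ k ∈ I, G k j + 12 / 5 * M ^ 2 := by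
          simp only [Finset.sum_add_distrib]
          congr 1
          · congr 2
            rw [hM]
            refine Finset.sum_congr rfl fun j hj => ?_
            rw [Finset.sum_ite_eq, if_pos hj]
          · rw [hM, sq, Finset.sum_mul_sum, Finset.mul_sum]
            exact Finset.sum_congr rfl fun j _ => by rw [Finset.mul_sum]
      _ ≤ (1 + 2 * C₁) * M + 12 / 5 * M ^ 2 := by
          rw [Finset.sum_comm (f := fun j k => G k j)]
          linarith

/-- For `β ≤ 1` the walk skips infinitely many sites with probability at least `11 / 27`. -/
theorem le_real_infinite_skipped (h : IsWalkFamily (upProb (perturbation β)) Q) (hβ : β ≤ 1)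
    (x : ℕ) : 11 / 27 ≤ (Q x).real {ω | {k | ω ∈ skipEvent k}.Infinite} := by
  have hP := h.isProbabilityMeasure x
  obtain ⟨A, N, hA, hw, hM, hsq⟩ := exists_second_moment_le h hβ x
  -- Weights are at most one, so a count above `R` means more than `R` skipped sites.
  let E : ℕ → Set (ℕ → ℕ) := fun R => ⋃ n, {ω | (R : ℝ) < skipCount β N n ω}
  have hEm : ∀ R, MeasurableSet (E R) := fun R => MeasurableSet.iUnion fun n =>
    measurableSet_lt measurable_const (measurable_skipCount β N n)
  have hEanti : Antitone E := fun R R' hRR => Set.iUnion_mono fun n ω hω =>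
    lt_of_le_of_lt (by exact_mod_cast hRR : (R : ℝ) ≤ R') hω
  have hER : ∀ R, 11 / 27 ≤ (Q x).real (E R) := by
    intro R
    -- Since `(11/27) * (12/5) = 44/45`, the spare `M² / 45` must absorb `2 R M` and the linear term
    -- in `A`.
    obtain ⟨n, hn⟩ := (hM.eventually_ge_atTop (45 * (2 * R + A) + R + 1)).exists
    obtain ⟨hi1, he1⟩ := integral_skipCount h x N n
    obtain ⟨hi2, he2⟩ := integral_skipCount_sq h x N n
    have hs := hsq n
    have hR0 : (0 : ℝ) ≤ R := Nat.cast_nonneg R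
    have hpz := sub_sq_le_integral_sq_mul (R := (R : ℝ)) (measurable_skipCount β N n) hi2 hi1 hR0
      (by rw [he1]; linarith)
    rw [he1, he2] at hpz
    set M := ∑ k ∈ Finset.Ioc N n, skipWeight β k * skipProb Q k x
    set V := ∑ j ∈ Finset.Ioc N n, ∑ k ∈ Finset.Ioc N n,
        skipWeight β j * skipWeight β k * (Q x).real (skipEvent j ∩ skipEvent k)
    set q := (Q x).real {ω | (R : ℝ) < skipCount β N n ω}
    have hq : q ≤ (Q x).real (E R) := h.real_mono x (Set.subset_iUnion
      (fun n => {ω | (R : ℝ) < skipCount β N n ω}) n)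
    refine le_trans ?_ hq
    have hq0 : 0 ≤ q := measureReal_nonneg
    have hMR : 0 < M - R := by linarith
    have hVq : 0 < V * q := lt_of_lt_of_le (by positivity) hpz
    have hV : 0 < V := by
      by_contra! hV
      nlinarith
    have hkey : 11 / 27 * (A * M + 12 / 5 * M ^ 2) ≤ (M - R) ^ 2 := by
      have hM0 : 0 ≤ M := by linarith
      have : 45 * (2 * R + A) * M ≤ M * M := by
        refine mul_le_mul_of_nonneg_right ?_ hM0
        linarith
      nlinarith [mul_nonneg hA hM0, sq_nonneg (R : ℝ)]
    by_contra! hlt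
    nlinarith
  have hsub : (⋂ R, E R) ⊆ {ω | {k | ω ∈ skipEvent k}.Infinite} := by
    intro ω hω hfin
    obtain ⟨n, hn⟩ := Set.mem_iUnion.1 (Set.mem_iInter.1 hω hfin.toFinset.card)
    have hle : skipCount β N n ω ≤ hfin.toFinset.card := by
      classical
      calc skipCount β N n ω
          ≤ ∑ k ∈ Finset.Ioc N n, if k ∈ hfin.toFinset then (1 : ℝ) else 0 := by
            refine Finset.sum_le_sum fun k hk => ?_
            have hwk := hw k (Finset.mem_Ioc.1 hk).1
            by_cases hωk : ω ∈ skipEvent k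
            · rw [if_pos (by simpa using hωk), Set.indicator_of_mem hωk]
              linarith
            · rw [if_neg (by simpa using hωk), Set.indicator_of_notMem hωk]
              simp
        _ = (((Finset.Ioc N n).filter (· ∈ hfin.toFinset)).card : ℝ) := by
            rw [Finset.sum_boole]
        _ ≤ hfin.toFinset.card := by
            exact_mod_cast Finset.card_le_card fun k hk => (Finset.mem_filter.1 hk).2
    exact absurd hn (not_lt.2 hle)
  refine le_trans ?_ (h.real_mono x hsub)
  have hlim : Tendsto (fun R => (Q x).real (E R)) atTop (𝓝 ((Q x).real (⋂ R, E R))) :=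
    (ENNReal.tendsto_toReal (measure_ne_top _ _)).comp
      (tendsto_measure_iInter_atTop (fun R => (hEm R).nullMeasurableSet) hEanti
        ⟨0, measure_ne_top _ _⟩)
  exact ge_of_tendsto hlim (Eventually.of_forall hER)

end Infinite

/-! ### Passage to an arbitrary chain. -/

theorem measurableSet_infinite_skipped :
    MeasurableSet {ω : ℕ → ℕ | {k | ω ∈ skipEvent k}.Infinite} := by
  have : {ω : ℕ → ℕ | {k | ω ∈ skipEvent k}.Infinite} =
      limsup (fun k => skipEvent k) atTop := by
    ext ω
    rw [Filter.mem_limsup_iff_frequently_mem, Nat.frequently_atTop_iff_infinite]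
    rfl
  rw [this]
  exact MeasurableSet.measurableSet_limsup measurableSet_skipEvent

theorem theorem1p2 {Ω : Type*} [MeasurableSpace Ω] (P : MeasureTheory.Measure Ω)
    [MeasureTheory.IsProbabilityMeasure P] (β : ℝ)
    (hp : ∀ n : ℕ, 1 ≤ n → upProb (perturbation β) n ∈ Set.Ioo (0 : ℝ) 1)
    (X : ℕ → Ω → ℕ)
    (hX : IsMarkovChainWith P (walkTransition (upProb (perturbation β))) X) :
    (1 < β → ∀ᵐ ω ∂P, (skippedPoints X ω).Finite) ∧
    (β ≤ 1 → (11 / 27 : ℝ) ≤ P.real {ω | (skippedPoints X ω).Infinite}) := by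
  have hup : IsUpProb (upProb (perturbation β)) := by
    refine ⟨by simp [upProb], fun n => ?_, fun n hn => (hp n hn).2⟩
    rcases Nat.eq_zero_or_pos n with rfl | hn
    · simp [upProb]
    · exact (hp n hn).1
  obtain ⟨Q, hQ⟩ := exists_isWalkFamily hup
  have hP := hQ.isProbabilityMeasure
  set I : Set (ℕ → ℕ) := {ω | {k | ω ∈ skipEvent k}.Infinite}
  have hmeas : Measurable (fun ω n => X n ω) := measurable_pi_lambda _ hX.measurable
  -- The law of `X` is a mixture of the `Q x`. Both claims hold for every starting point with the
  -- same constant, so they average.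
  have hPI : P {ω | (skippedPoints X ω).Infinite} = ∑' x, P {ω | X 0 ω = x} * Q x I := by
    have h1 := congrArg (fun μ => μ I) (hQ.map_eq_sum hX)
    rw [Measure.map_apply hmeas measurableSet_infinite_skipped,
      Measure.sum_apply _ measurableSet_infinite_skipped] at h1
    exact h1
  constructor
  · intro hβ
    have hz : P {ω | (skippedPoints X ω).Infinite} = 0 := by
      rw [hPI, ENNReal.tsum_eq_zero]
      intro x
      have : Q x I = 0 := by
        have := ae_finite_skipped hQ hβ x
        rw [ae_iff] at this
        exact this
      rw [this, mul_zero]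
    rw [ae_iff]
    exact hz
  · intro hβ
    have hsum : ∑' x, P {ω | X 0 ω = x} = 1 := by
      have h1 := congrArg (fun μ => μ Set.univ) (hQ.map_eq_sum hX)
      rw [Measure.map_apply hmeas .univ, Measure.sum_apply _ .univ] at h1
      simpa using h1.symm
    have hle : ENNReal.ofReal (11 / 27) ≤ P {ω | (skippedPoints X ω).Infinite} := by
      rw [hPI]
      calc ENNReal.ofReal (11 / 27) = ∑' x, P {ω | X 0 ω = x} * ENNReal.ofReal (11 / 27) := by
            rw [ENNReal.tsum_mul_right, hsum, one_mul]
        _ ≤ _ := by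
            refine ENNReal.tsum_le_tsum fun x => ?_
            gcongr
            exact (ENNReal.ofReal_le_iff_le_toReal (measure_ne_top _ _)).2
              (le_real_infinite_skipped hQ hβ x)
    exact (ENNReal.ofReal_le_iff_le_toReal (measure_ne_top _ _)).1 hle
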